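/- Let $(V,\otimes,k)$ be a commutative quantale with $\bot<k$, and let $\mathcal T=(\mathbb T,V,\xi)$ be a (strict) topological theory. That is, $\mathbb T=(T,e,m)$ is a monad on $\mathbf{Set}$ such that $T$ sends pullbacks to weak pullbacks and every naturality square of $m$ is a weak pullback, and $\xi:TV\to V$ is a $\mathbb T$-algebra structure for which $\otimes:V\times V\to V$ and $k:1\to V$ are $\mathbb T$-homomorphisms and for which the maps $V^X\to V^{TX}$, $\varphi\mapsto \xi\cdot T\varphi$, are monotone and natural in $X$ with respect to the direct image maps $V^X\to V^Y$, $\varphi\mapsto\bigl(y\mapsto\bigvee_{f(x)=y}\varphi(x)\bigr)$, $f:X\to Y$. For $r:X\times Y\to V$ put $T_\xi r(\mathfrak x,\mathfrak y)=\bigvee\{\xi\cdot Tr(\mathfrak w)\mid \mathfrak w\in T(X\times Y),\ T\pi_1(\mathfrak w)=\mathfrak x,\ T\pi_2(\mathfrak w)=\mathfrak y\}$. For $\alpha:TX\times Y\to V$ and $\beta:TY\times Z\to V$ put $$(\beta\circ\alpha)(\mathfrak x,z)=\bigvee_{\mathfrak y\in TY}\ \bigvee_{\mathfrak X\in TTX,\,m_X(\mathfrak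 X)=\mathfrak x}T_\xi\alpha(\mathfrak X,\mathfrak y)\otimes\beta(\mathfrak y,z),$$ and write $\gamma\mapsto\gamma/\alpha$ for the right adjoint of $-\circ\alpha$ (for the pointwise order). A $\mathcal T$-category is a set $X$ with a map $a:TX\times X\to V$ such that $k\le a(e_X(x),x)$ and $T_\xi a(\mathfrak X,\mathfrak x)\otimes a(\mathfrak x,x)\le a(m_X(\mathfrak X),x)$. A $\mathcal T$-functor $f:(X,a)\to(Y,b)$ is a map with $a(\mathfrak x,x)\le b(Tf(\mathfrak x),f(x))$. Put $f_*(\mathfrak x,y)=b(Tf(\mathfrak x),y)$, $f^*(\mathfrak y,x)=b(\mathfrak y,f(x))$, and $f\le g$ if $f^*\le g^*$ pointwise. A $\mathcal T$-functor $f:X\to Y$ is left adjoint if there is a $\mathcal T$-functor $g:Y\to X$ with $1_X\le g\cdot f$ and $f\cdot g\le 1_Y$. A $\mathcal T$-category $X$ is L-separated if, for all $\mathcal T$-functors $f,g$ with codomain $X$ and common domain, $f\le g$ and $g\le f$ imply $f=g$. A $\mathcal T$-module from $(Y,b)$ to $(Z,c)$ is a map $\psi:TY\times Z\to V$ with $\psi\circ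 b\le\psi$ and $c\circ\psi\le\psi$. A $\mathcal T$-category $X$ is cocomplete if for every $\mathcal T$-functor $h:Y\to X$ and every $\mathcal T$-module $\psi$ from $Y$ to $Z$ there is a $\mathcal T$-functor $g:Z\to X$ with $g_*=h_*/\psi$. Let $\mathbf{CocomplSep}_{\mathcal T}$ be the category of L-separated cocomplete $\mathcal T$-categories and left adjoint $\mathcal T$-functors. Let $\mathbf{CatSep}_V$ be the category of L-separated $V$-categories and $V$-functors, where $V$-categories, $V$-functors and L-separatedness are the above notions for the identity theory $(\mathrm{Id},V,1_V)$. **Theorem.** The forgetful functor $S:\mathbf{CocomplSep}_{\mathcal T}\to\mathbf{CatSep}_V$, which sends $(X,a)$ to its underlying $V$-category $(X,a\cdot e_X)$, i.e. $X$ with the structure $(x,y)\mapsto a(e_X(x),y)$, and which is the identity on underlying maps, is monadic. That is, $S$ has a left adjoint and the comparison functor from $\mathbf{CocomplSep}_{\mathcal T}$ to the Eilenberg–Moore category of the induced monad on $\mathbf{CatSep}_V$ is an equivalence of categories. -/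

import Mathlib

open CategoryTheory

universe u

namespace TopTheory

/-- A commutative square `f ∘ p = g ∘ q` of maps is a weak pullback if the induced map
`P → X ×_Z Y` is surjective. -/
def IsWeakPullback {P X Y Z : Type u} (p : P → X) (q : P → Y) (f : X → Z) (g : Y → Z) : Prop :=
  (∀ w, f (p w) = g (q w)) ∧ ∀ x y, f x = g y → ∃ w, p w = x ∧ q w = y

/-- A (strict) topological theory `(T, V, ξ)` over the commutative quantale `V`
(with tensor product `*` and neutral element `1`). -/
structure TopologicalTheory (V : Type u) [CommMonoid V] [CompleteLattice V] [IsQuantale V] where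
  /-- the monad `(T, e, m)` on the category of sets -/
  T : Monad (Type u)
  /-- `T` sends pullbacks to weak pullbacks -/
  bc_functor : ∀ {P X Y Z : Type u} (p : P ⟶ X) (q : P ⟶ Y) (f : X ⟶ Z) (g : Y ⟶ Z),
    IsPullback p q f g → IsWeakPullback (T.map p) (T.map q) (T.map f) (T.map g)
  /-- the naturality squares of `m` are weak pullbacks -/
  bc_mul : ∀ {X Y : Type u} (f : X ⟶ Y),
    IsWeakPullback (T.μ.app X) (T.map (T.map f)) (T.map f) (T.μ.app Y)
  /-- the map `ξ : T V → V` -/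
  ξ : T.obj V → V
  /-- `ξ` is a `T`-algebra structure: unit law -/
  ξ_unit : ∀ v : V, ξ (T.η.app V v) = v
  /-- `ξ` is a `T`-algebra structure: associativity law -/
  ξ_mul : ∀ w : T.obj (T.obj V), ξ (T.map (↾ξ) w) = ξ (T.μ.app V w)
  /-- `k : 1 → V` is a `T`-algebra homomorphism -/
  ξ_one : ∀ t : T.obj PUnit.{u + 1}, ξ (T.map (↾fun _ => (1 : V)) t) = 1
  /-- `⊗ : V × V → V` is a `T`-algebra homomorphism -/
  ξ_tensor : ∀ w : T.obj (V × V), ξ (T.map (↾fun p : V × V => p.1 * p.2) w) =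
    ξ (T.map (↾(Prod.fst : V × V → V)) w) * ξ (T.map (↾(Prod.snd : V × V → V)) w)
  /-- `φ ↦ ξ ∘ T φ` is a monotone map `V ^ X → V ^ (T X)` -/
  ξ_mono : ∀ {X : Type u} (φ ψ : X → V), (∀ x, φ x ≤ ψ x) →
    ∀ t : T.obj X, ξ (T.map (↾φ) t) ≤ ξ (T.map (↾ψ) t)
  /-- `φ ↦ ξ ∘ T φ` is natural with respect to the direct image maps
  `V ^ X → V ^ Y, φ ↦ (y ↦ ⨆ f x = y, φ x)` -/
  ξ_natural : ∀ {X Y : Type u} (f : X → Y) (φ : X → V) (t : T.obj Y),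
    ξ (T.map (↾fun y => ⨆ (x : X) (_ : f x = y), φ x) t) =
      ⨆ (s : T.obj X) (_ : T.map (↾f) s = t), ξ (T.map (↾φ) s)

section

variable {V : Type u} [CommMonoid V] [CompleteLattice V] [IsQuantale V]

/-! ### The identity theory -/

/-- The identity theory `(Id, V, 1_V)`; its categories are the `V`-categories. -/
def idTheory (V : Type u) [CommMonoid V] [CompleteLattice V] [IsQuantale V] :
    TopologicalTheory V where
  T := Monad.id (Type u)
  bc_functor := by
    intro P X Y Z p q f g h
    refine ⟨fun w => ConcreteCategory.congr_hom h.w w, fun x y hxy => ?_⟩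
    let a : PUnit.{u + 1} ⟶ X := ↾fun _ => x
    let b : PUnit.{u + 1} ⟶ Y := ↾fun _ => y
    have hab : a ≫ f = b ≫ g := by
      ext t
      exact hxy
    exact ⟨h.lift a b hab PUnit.unit, ConcreteCategory.congr_hom (h.lift_fst a b hab) PUnit.unit,
      ConcreteCategory.congr_hom (h.lift_snd a b hab) PUnit.unit⟩
  bc_mul := fun {X Y} f => ⟨fun _ => rfl, fun x _ hxy => ⟨x, rfl, hxy⟩⟩
  ξ := fun v => v
  ξ_unit := fun _ => rfl
  ξ_mul := fun _ => rfl
  ξ_one := fun _ => rfl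
  ξ_tensor := fun _ => rfl
  ξ_mono := fun _ _ h t => h t
  ξ_natural := fun _ _ _ => rfl

/-! ### `V`-relations and `T`-relations -/

variable (𝒯 : TopologicalTheory V)

/-- The action of `T` on maps. -/
abbrev TopologicalTheory.map {X Y : Type u} (f : X → Y) : 𝒯.T.obj X → 𝒯.T.obj Y :=
  𝒯.T.map (↾f)

/-- The unit `e_X : X → T X`. -/
abbrev TopologicalTheory.e (X : Type u) : X → 𝒯.T.obj X := 𝒯.T.η.app X

/-- The multiplication `m_X : T T X → T X`. -/
abbrev TopologicalTheory.m (X : Type u) : 𝒯.T.obj (𝒯.T.obj X) → 𝒯.T.obj X := 𝒯.T.μ.app X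

/-- The composite `s · r` of `V`-relations. -/
def relComp {X Y Z : Type u} (s : Y → Z → V) (r : X → Y → V) : X → Z → V :=
  fun x z => ⨆ y, r x y * s y z

/-- The extension of the `V`-relation `r` along the `V`-relation `t`, i.e. the value at `r` of the
right adjoint of `- · t`. -/
def relExt {X Y Z : Type u} (r : X → Y → V) (t : X → Z → V) : Z → Y → V :=
  fun z y => ⨅ x, Quantale.leftMulResiduation (t x z) (r x y)

/-- The extension `T_ξ r : T X × T Y → V` of a `V`-relation `r : X × Y → V`. -/
def Txi {X Y : Type u} (r : X → Y → V) : 𝒯.T.obj X → 𝒯.T.obj Y → V :=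
  fun x y => ⨆ (w : 𝒯.T.obj (X × Y)) (_ : 𝒯.map Prod.fst w = x) (_ : 𝒯.map Prod.snd w = y),
    𝒯.ξ (𝒯.map (fun p : X × Y => r p.1 p.2) w)

/-- For a `T`-relation `α : T X × Y → V`, the `V`-relation `T_ξ α · m_X°` from `T X` to `T Y`. -/
def TxiM {X Y : Type u} (α : 𝒯.T.obj X → Y → V) : 𝒯.T.obj X → 𝒯.T.obj Y → V :=
  fun x y => ⨆ (t : 𝒯.T.obj (𝒯.T.obj X)) (_ : 𝒯.m X t = x), Txi 𝒯 α t y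

/-- Kleisli convolution `β ∘ α = β · T_ξ α · m_X°` of `T`-relations. -/
def kleisli {X Y Z : Type u} (β : 𝒯.T.obj Y → Z → V) (α : 𝒯.T.obj X → Y → V) :
    𝒯.T.obj X → Z → V :=
  relComp β (TxiM 𝒯 α)

/-- The extension of the `T`-relation `γ` along the `T`-relation `α`, i.e. the value at `γ` of the
right adjoint of `- ∘ α`. -/
def kleisliExt {X Y Z : Type u} (γ : 𝒯.T.obj X → Z → V) (α : 𝒯.T.obj X → Y → V) :
    𝒯.T.obj Y → Z → V :=
  relExt γ (TxiM 𝒯 α)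

theorem relComp_le_iff {X Y Z : Type u} (s : Z → Y → V) (t : X → Z → V) (r : X → Y → V) :
    relComp s t ≤ r ↔ s ≤ relExt r t := by
  simp only [Pi.le_def, relComp, relExt, iSup_le_iff, le_iInf_iff,
    Quantale.leftMulResiduation_le_iff_mul_le]
  constructor
  · intro h z y x
    rw [mul_comm]
    exact h x y z
  · intro h x y z
    rw [mul_comm]
    exact h z y x

theorem kleisli_le_iff {X Y Z : Type u} (β : 𝒯.T.obj Y → Z → V) (α : 𝒯.T.obj X → Y → V)
    (γ : 𝒯.T.obj X → Z → V) : kleisli 𝒯 β α ≤ γ ↔ β ≤ kleisliExt 𝒯 γ α :=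
  relComp_le_iff _ _ _

/-! ### `T`-categories and `T`-functors -/

/-- A `T`-category: a set `X` with a `T`-relation `a : T X × X → V` such that `e_X° ≤ a` and
`a ∘ a ≤ a` (spelled out elementwise). -/
structure TCat where
  /-- the underlying set -/
  carrier : Type u
  /-- the structure `a` -/
  str : 𝒯.T.obj carrier → carrier → V
  refl : ∀ x, 1 ≤ str (𝒯.e carrier x) x
  trans : ∀ (t : 𝒯.T.obj (𝒯.T.obj carrier)) (y : 𝒯.T.obj carrier) (x : carrier),
    Txi 𝒯 str t y * str y x ≤ str (𝒯.m carrier t) x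

variable {𝒯}

/-- A `T`-functor. -/
@[ext]
structure TFunctor (X Y : TCat 𝒯) where
  /-- the underlying map -/
  toFun : X.carrier → Y.carrier
  str_le : ∀ t x, X.str t x ≤ Y.str (𝒯.map toFun t) (toFun x)

/-- The identity `T`-functor. -/
def TFunctor.id (X : TCat 𝒯) : TFunctor X X where
  toFun := fun x => x
  str_le := fun t x => by
    have : 𝒯.map (fun x : X.carrier => x) t = t :=
      ConcreteCategory.congr_hom (𝒯.T.map_id X.carrier) t
    rw [this]

/-- The composite `g · f` of `T`-functors. -/
def TFunctor.comp {X Y Z : TCat 𝒯} (g : TFunctor Y Z) (f : TFunctor X Y) : TFunctor X Z where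
  toFun := fun x => g.toFun (f.toFun x)
  str_le := fun t x => by
    have : 𝒯.map (fun x => g.toFun (f.toFun x)) t = 𝒯.map g.toFun (𝒯.map f.toFun t) :=
      ConcreteCategory.congr_hom (𝒯.T.map_comp (↾f.toFun) (↾g.toFun)) t
    rw [this]
    exact (f.str_le t x).trans (g.str_le _ _)

/-- The category of `T`-categories and `T`-functors. -/
instance : Category (TCat 𝒯) where
  Hom := TFunctor
  id := TFunctor.id
  comp := fun f g => g.comp f

/-- The `T`-relation `f_* = b · T f`. -/
def TFunctor.lowerStar {X Y : TCat 𝒯} (f : TFunctor X Y) : 𝒯.T.obj X.carrier → Y.carrier → V :=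
  fun t y => Y.str (𝒯.map f.toFun t) y

/-- The `T`-relation `f^* = f° · b`. -/
def TFunctor.upperStar {X Y : TCat 𝒯} (f : TFunctor X Y) : 𝒯.T.obj Y.carrier → X.carrier → V :=
  fun t x => Y.str t (f.toFun x)

/-- The order on `T`-functors: `f ≤ g` if and only if `f^* ≤ g^*`. -/
instance (X Y : TCat 𝒯) : Preorder (TFunctor X Y) := Preorder.lift TFunctor.upperStar

/-- `X` is L-separated: equivalent `T`-functors with codomain `X` are equal. -/
def IsLSeparated (X : TCat 𝒯) : Prop :=
  ∀ (Y : TCat 𝒯) (f g : TFunctor Y X), f ≤ g → g ≤ f → f = g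

/-- `f` is a left adjoint `T`-functor. -/
def TFunctor.IsLeftAdjoint {X Y : TCat 𝒯} (f : TFunctor X Y) : Prop :=
  ∃ g : TFunctor Y X, TFunctor.id X ≤ g.comp f ∧ f.comp g ≤ TFunctor.id Y

/-- `φ` is a `T`-module from `X` to `Y`. -/
def IsModule (X Y : TCat 𝒯) (φ : 𝒯.T.obj X.carrier → Y.carrier → V) : Prop :=
  kleisli 𝒯 φ X.str ≤ φ ∧ kleisli 𝒯 Y.str φ ≤ φ

/-- `g` is a `ψ`-weighted colimit of `h`: it represents the extension of `h_*` along `ψ`. -/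
def IsWeightedColimit {X Y Z : TCat 𝒯} (ψ : 𝒯.T.obj Y.carrier → Z.carrier → V)
    (h : TFunctor Y X) (g : TFunctor Z X) : Prop :=
  kleisliExt 𝒯 h.lowerStar ψ = g.lowerStar

/-- `X` is cocomplete: every weighted diagram in `X` has a colimit. -/
def IsCocomplete (X : TCat 𝒯) : Prop :=
  ∀ (Y Z : TCat 𝒯) (h : TFunctor Y X) (ψ : 𝒯.T.obj Y.carrier → Z.carrier → V),
    IsModule Y Z ψ → ∃ g : TFunctor Z X, IsWeightedColimit ψ h g

/-! ### Left adjoint `T`-functors compose -/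

theorem map_e (𝒯 : TopologicalTheory V) {X Y : Type u} (f : X → Y) (x : X) :
    𝒯.map f (𝒯.e X x) = 𝒯.e Y (f x) :=
  (ConcreteCategory.congr_hom (𝒯.T.η.naturality (↾f)) x).symm

/-- `e` is op-lax natural for `T_ξ`. -/
theorem le_Txi_e (𝒯 : TopologicalTheory V) {X Y : Type u} (r : X → Y → V) (x : X) (y : Y) :
    r x y ≤ Txi 𝒯 r (𝒯.e X x) (𝒯.e Y y) := by
  refine le_iSup_of_le (𝒯.e (X × Y) (x, y))
    (le_iSup₂_of_le (map_e 𝒯 _ _) (map_e 𝒯 _ _) ?_)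
  rw [map_e]
  exact (𝒯.ξ_unit _).ge

theorem m_e (𝒯 : TopologicalTheory V) {X : Type u} (t : 𝒯.T.obj X) :
    𝒯.m X (𝒯.e _ t) = t :=
  ConcreteCategory.congr_hom (𝒯.T.left_unit X) t

theorem TCat.str_mul_le (X : TCat 𝒯) (t : 𝒯.T.obj X.carrier) (x y : X.carrier) :
    X.str t x * X.str (𝒯.e _ x) y ≤ X.str t y := by
  calc X.str t x * X.str (𝒯.e _ x) y
      ≤ Txi 𝒯 X.str (𝒯.e _ t) (𝒯.e _ x) * X.str (𝒯.e _ x) y := by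
        gcongr
        exact le_Txi_e 𝒯 X.str t x
    _ ≤ X.str (𝒯.m _ (𝒯.e _ t)) y := X.trans _ _ _
    _ = X.str t y := by rw [m_e]

theorem TFunctor.le_iff {X Y : TCat 𝒯} (f g : TFunctor X Y) :
    f ≤ g ↔ ∀ x, 1 ≤ Y.str (𝒯.e _ (f.toFun x)) (g.toFun x) := by
  constructor
  · intro h x
    exact (Y.refl _).trans (h _ x)
  · intro h t x
    calc Y.str t (f.toFun x) = Y.str t (f.toFun x) * 1 := (mul_one _).symm
      _ ≤ Y.str t (f.toFun x) * Y.str (𝒯.e _ (f.toFun x)) (g.toFun x) := by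
        gcongr
        exact h x
      _ ≤ Y.str t (g.toFun x) := Y.str_mul_le _ _ _

theorem TFunctor.comp_le_comp_left {X Y Z : TCat 𝒯} (h : TFunctor Y Z) {f g : TFunctor X Y}
    (hfg : f ≤ g) : h.comp f ≤ h.comp g := by
  rw [TFunctor.le_iff] at hfg ⊢
  intro x
  refine (hfg x).trans ((h.str_le _ _).trans ?_)
  rw [map_e]
  rfl

theorem TFunctor.comp_le_comp_right {X Y Z : TCat 𝒯} {f g : TFunctor Y Z} (hfg : f ≤ g)
    (h : TFunctor X Y) : f.comp h ≤ g.comp h :=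
  fun t x => hfg t (h.toFun x)

theorem TFunctor.IsLeftAdjoint.id (X : TCat 𝒯) : (TFunctor.id X).IsLeftAdjoint :=
  ⟨TFunctor.id X, le_rfl, le_rfl⟩

theorem TFunctor.IsLeftAdjoint.comp {X Y Z : TCat 𝒯} {g : TFunctor Y Z} {f : TFunctor X Y}
    (hg : g.IsLeftAdjoint) (hf : f.IsLeftAdjoint) : (g.comp f).IsLeftAdjoint := by
  obtain ⟨f', hf₁, hf₂⟩ := hf
  obtain ⟨g', hg₁, hg₂⟩ := hg
  refine ⟨f'.comp g', ?_, ?_⟩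
  · exact hf₁.trans (TFunctor.comp_le_comp_left f' (TFunctor.comp_le_comp_right hg₁ f))
  · exact (TFunctor.comp_le_comp_left g (TFunctor.comp_le_comp_right hf₂ g')).trans hg₂

/-! ### The categories of L-separated (cocomplete) `T`-categories -/

/-- The full subcategory of L-separated `T`-categories. -/
abbrev CatSep (𝒯 : TopologicalTheory V) := ObjectProperty.FullSubcategory (IsLSeparated (𝒯 := 𝒯))

/-- An L-separated cocomplete `T`-category. -/
structure CocomplSep (𝒯 : TopologicalTheory V) where
  /-- the underlying `T`-category -/
  obj : TCat 𝒯
  sep : IsLSeparated obj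
  cocomplete : IsCocomplete obj

/-- A morphism of L-separated cocomplete `T`-categories: a left adjoint `T`-functor. -/
@[ext]
structure CocomplSep.Hom {𝒯 : TopologicalTheory V} (X Y : CocomplSep 𝒯) where
  /-- the underlying `T`-functor -/
  fn : TFunctor X.obj Y.obj
  isLeftAdjoint : fn.IsLeftAdjoint

/-- The category of L-separated cocomplete `T`-categories and left adjoint `T`-functors. -/
instance : Category (CocomplSep 𝒯) where
  Hom := CocomplSep.Hom
  id := fun X => ⟨TFunctor.id X.obj, TFunctor.IsLeftAdjoint.id X.obj⟩
  comp := fun f g => ⟨g.fn.comp f.fn, g.isLeftAdjoint.comp f.isLeftAdjoint⟩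

/-! ### The forgetful functor to `V`-categories -/

theorem Txi_idTheory {X Y : Type u} (r : X → Y → V) (x : X) (y : Y) :
    Txi (idTheory V) r x y = r x y := by
  apply le_antisymm
  · refine iSup_le fun w => iSup₂_le ?_
    rintro rfl rfl
    exact le_rfl
  · exact le_Txi_e (idTheory V) r x y

/-- The underlying `V`-category `(X, a · e_X)` of a `T`-category `(X, a)`. -/
def TCat.toVCat (X : TCat 𝒯) : TCat (idTheory V) where
  carrier := X.carrier
  str := fun x y => X.str (𝒯.e X.carrier x) y
  refl := X.refl
  trans := fun t y x => by
    refine le_trans (mul_le_mul_left ?_ _) (X.str_mul_le (𝒯.e X.carrier t) y x)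
    exact (Txi_idTheory (fun x y => X.str (𝒯.e X.carrier x) y) t y).le

/-- The underlying `V`-functor of a `T`-functor. -/
def TFunctor.toVFunctor {X Y : TCat 𝒯} (f : TFunctor X Y) : TFunctor X.toVCat Y.toVCat where
  toFun := f.toFun
  str_le := fun t x => by
    refine (f.str_le (𝒯.e X.carrier t) x).trans (le_of_eq ?_)
    exact congrArg (fun s => Y.str s (f.toFun x)) (map_e 𝒯 f.toFun t)

/-- The forgetful functor from `T`-categories to `V`-categories. -/
def forgetToV (𝒯 : TopologicalTheory V) : TCat 𝒯 ⥤ TCat (idTheory V) where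
  obj := TCat.toVCat
  map := fun f => TFunctor.toVFunctor f

/-- The discrete `T`-category `(X, e_X°)`. -/
def TCat.discrete (𝒯 : TopologicalTheory V) (X : Type u) : TCat 𝒯 where
  carrier := X
  str := fun t x => ⨆ (_ : 𝒯.e X x = t), (1 : V)
  refl := fun x => le_iSup_of_le rfl le_rfl
  trans := fun t y x => by
    rw [← Quantale.leftMulResiduation_le_iff_mul_le]
    refine iSup_le fun w => iSup_le fun h₁ => iSup_le fun h₂ => ?_
    have key : (fun p : 𝒯.T.obj X × X => ⨆ (_ : 𝒯.e X p.2 = p.1), (1 : V)) =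
        fun p => ⨆ (z : X) (_ : (𝒯.e X z, z) = p), (fun _ => (1 : V)) z := by
      funext p
      apply le_antisymm
      · exact iSup_le fun h => le_iSup₂_of_le p.2 (Prod.ext h rfl) le_rfl
      · refine iSup₂_le fun z h => ?_
        subst h
        exact le_iSup_of_le rfl le_rfl
    rw [key]
    erw [𝒯.ξ_natural (fun z : X => (𝒯.e X z, z)) (fun _ => (1 : V)) w]
    refine iSup_le fun s => iSup_le fun hs => ?_
    rw [Quantale.leftMulResiduation_le_iff_mul_le, ← Quantale.rightMulResiduation_le_iff_mul_le]
    refine iSup_le fun hx => ?_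
    rw [Quantale.rightMulResiduation_le_iff_mul_le]
    have hsy : s = y := by
      rw [← h₂, ← hs]
      have h := ConcreteCategory.congr_hom
        (𝒯.T.map_comp (↾fun z : X => (𝒯.e X z, z)) (↾(Prod.snd : 𝒯.T.obj X × X → X))) s
      have h' := ConcreteCategory.congr_hom (𝒯.T.map_id X) s
      exact h'.symm.trans h
    have hst : 𝒯.map (𝒯.e X) s = t := by
      rw [← h₁, ← hs]
      exact ConcreteCategory.congr_hom
        (𝒯.T.map_comp (↾fun z : X => (𝒯.e X z, z)) (↾(Prod.fst : 𝒯.T.obj X × X → 𝒯.T.obj X))) s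
    have hm : 𝒯.m X t = s := by
      rw [← hst]
      exact ConcreteCategory.congr_hom (𝒯.T.right_unit X) s
    have hone : 𝒯.ξ (𝒯.map (fun _ : X => (1 : V)) s) = 1 := by
      have h := ConcreteCategory.congr_hom
        (𝒯.T.map_comp (↾fun _ : X => PUnit.unit.{u + 1}) (↾fun _ : PUnit.{u + 1} => (1 : V))) s
      exact (congrArg 𝒯.ξ h).trans (𝒯.ξ_one _)
    rw [mul_one]
    exact hone.le.trans (le_iSup_of_le (by rw [hm, hsy, hx]) le_rfl)

/-- The underlying `V`-category of an L-separated `T`-category is L-separated. -/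
theorem IsLSeparated.toVCat {X : TCat 𝒯} (hX : IsLSeparated X) : IsLSeparated X.toVCat := by
  intro Z f g hfg hgf
  rw [TFunctor.le_iff] at hfg hgf
  let pt : X.carrier → TFunctor (TCat.discrete 𝒯 PUnit.{u + 1}) X := fun x =>
    { toFun := fun _ => x
      str_le := fun t z => iSup_le fun h => by
        subst h
        refine (X.refl x).trans (le_of_eq ?_)
        exact congrArg (fun s => X.str s x)
          (map_e 𝒯 (fun _ : PUnit.{u + 1} => x) z).symm }
  ext z
  have h : pt (f.toFun z) = pt (g.toFun z) :=
    hX _ _ _ ((TFunctor.le_iff _ _).2 fun _ => hfg z) ((TFunctor.le_iff _ _).2 fun _ => hgf z)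
  exact congrFun (congrArg TFunctor.toFun h) PUnit.unit

/-- The forgetful functor `S` from L-separated cocomplete `T`-categories (and left adjoint
`T`-functors) to L-separated `V`-categories (and `V`-functors). -/
def forgetCocomplSep (𝒯 : TopologicalTheory V) : CocomplSep 𝒯 ⥤ CatSep (idTheory V) where
  obj := fun X => ⟨(forgetToV 𝒯).obj X.obj, X.sep.toVCat⟩
  map := fun f => ObjectProperty.homMk ((forgetToV 𝒯).map f.fn)

end

end TopTheory

/-! A `V`-relation `r` extends to `T_ξ r`, and because `T` and `m` satisfy Beck–Chevalley and `ξ` is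
a `⊗`-compatible algebra natural for direct images, `T_ξ` preserves relational composition and is
compatible with maps and with `m`. Hence Kleisli convolution is associative (`kleisli_assoc`), and
the usual calculus of modules is available.

Left adjoint of `S`. Modules from `X` to the point form a `T`-category `X.psh` in which hom is the
extension of evaluation along itself. The Yoneda lemma (`TCat.kleisliExt_yoneda`) shows that it is
the free cocompletion: every `T`-functor from `X` into an L-separated cocomplete `Y` extends along
Yoneda to exactly one left adjoint (`exists_extension`, `extension_unique`). A `V`-category `(X, r)`
generates the `T`-category `(X, e° · T_ξ r)`; the free cocompletion of that is the value of the left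
adjoint.

Monadicity is Beck's theorem for `S`-split pairs. A cocomplete L-separated `Y` is representable: a
map `lim : T Y → Y` carries its structure, it is a `T`-algebra, and left adjoints preserve it. If `S
f`, `S g` have a split coequalizer `q : Y → Q`, then `lim` descends to `Q` and makes it a
`T`-category. The essential point is that `q` has a right adjoint
(`TFunctor.exists_rightAdjoint_of_split`); then `Q` is a retract of `Y` along an adjunction, hence
cocomplete, and `q` is a coequalizer that `S` preserves. Isomorphisms are reflected because the
right adjoint of a bijective `f` with `V`-functorial inverse must be that inverse. -/

namespace TopTheory

/-! ### Functoriality of `T_ξ` and associativity of Kleisli convolution. -/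

section Relations

variable {V : Type u} [CommMonoid V] [CompleteLattice V] [IsQuantale V] (𝒯 : TopologicalTheory V)

/-! ### The monad `T` on maps -/

theorem map_id_apply {X : Type u} (t : 𝒯.T.obj X) : 𝒯.map (fun x : X => x) t = t :=
  ConcreteCategory.congr_hom (𝒯.T.map_id X) t

theorem map_map {X Y Z : Type u} (f : X → Y) (g : Y → Z) (t : 𝒯.T.obj X) :
    𝒯.map g (𝒯.map f t) = 𝒯.map (fun x => g (f x)) t :=
  (ConcreteCategory.congr_hom (𝒯.T.map_comp (↾f) (↾g)) t).symm

theorem map_m {X Y : Type u} (f : X → Y) (t : 𝒯.T.obj (𝒯.T.obj X)) :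
    𝒯.map f (𝒯.m X t) = 𝒯.m Y (𝒯.map (𝒯.map f) t) :=
  (ConcreteCategory.congr_hom (𝒯.T.μ.naturality (↾f)) t).symm

theorem m_map_e {X : Type u} (t : 𝒯.T.obj X) : 𝒯.m X (𝒯.map (𝒯.e X) t) = t :=
  ConcreteCategory.congr_hom (𝒯.T.right_unit X) t

theorem m_map_m {X : Type u} (t : 𝒯.T.obj (𝒯.T.obj (𝒯.T.obj X))) :
    𝒯.m X (𝒯.map (𝒯.m X) t) = 𝒯.m X (𝒯.m _ t) :=
  ConcreteCategory.congr_hom (𝒯.T.assoc X) t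

theorem exists_lift {X Y Z : Type u} (f : X → Z) (g : Y → Z) (t : 𝒯.T.obj X) (s : 𝒯.T.obj Y)
    (h : 𝒯.map f t = 𝒯.map g s) :
    ∃ w : 𝒯.T.obj {p : X × Y // f p.1 = g p.2},
      𝒯.map (fun p => p.1.1) w = t ∧ 𝒯.map (fun p => p.1.2) w = s :=
  (𝒯.bc_functor (↾fun p : {p : X × Y // f p.1 = g p.2} => p.1.1) (↾fun p => p.1.2) (↾f) (↾g)
    ⟨⟨(Limits.Types.pullbackCone (↾f) (↾g)).condition⟩,
      ⟨(Limits.Types.pullbackLimitCone (↾f) (↾g)).isLimit⟩⟩).2 t s h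

theorem exists_m_lift {X Y : Type u} (f : X → Y) (t : 𝒯.T.obj X) (s : 𝒯.T.obj (𝒯.T.obj Y))
    (h : 𝒯.map f t = 𝒯.m Y s) :
    ∃ w : 𝒯.T.obj (𝒯.T.obj X), 𝒯.m X w = t ∧ 𝒯.map (𝒯.map f) w = s :=
  (𝒯.bc_mul (↾f)).2 t s h

/-! ### The extension `T_ξ` -/

variable {X Y Z X' Y' W : Type u}

theorem Txi_le_iff (r : X → Y → V) (t : 𝒯.T.obj X) (s : 𝒯.T.obj Y) (v : V) :
    Txi 𝒯 r t s ≤ v ↔ ∀ w : 𝒯.T.obj (X × Y), 𝒯.map Prod.fst w = t → 𝒯.map Prod.snd w = s →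
      𝒯.ξ (𝒯.map (fun p : X × Y => r p.1 p.2) w) ≤ v := by
  simp only [Txi, iSup_le_iff]

/-- Any span `X ← W → Y` supplies witnesses: the image of `w` under `T (p, q)` competes in the
supremum. Most lower bounds on `T_ξ` come from this. -/
theorem le_Txi (r : X → Y → V) (p : W → X) (q : W → Y) (φ : W → V)
    (h : ∀ w, φ w ≤ r (p w) (q w)) (w : 𝒯.T.obj W) :
    𝒯.ξ (𝒯.map φ w) ≤ Txi 𝒯 r (𝒯.map p w) (𝒯.map q w) := by
  refine (𝒯.ξ_mono φ _ h w).trans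
    (le_iSup_of_le (𝒯.map (fun w => (p w, q w)) w) (le_iSup₂_of_le ?_ ?_ (le_of_eq ?_))) <;>
  · rw [map_map]

theorem Txi_mono {r r' : X → Y → V} (h : ∀ x y, r x y ≤ r' x y) (t : 𝒯.T.obj X)
    (s : 𝒯.T.obj Y) : Txi 𝒯 r t s ≤ Txi 𝒯 r' t s := by
  rw [Txi_le_iff]
  rintro w rfl rfl
  exact le_Txi 𝒯 r' _ _ _ (fun p => h p.1 p.2) w

/-- For `≥`, a witness over `T f t` lifts to the pullback of `f` and the first projection, since `T`
sends it to a weak pullback. -/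
theorem Txi_map_left (f : X → X') (r : X' → Y → V) (t : 𝒯.T.obj X) (s : 𝒯.T.obj Y) :
    Txi 𝒯 (fun x y => r (f x) y) t s = Txi 𝒯 r (𝒯.map f t) s := by
  apply le_antisymm
  · rw [Txi_le_iff]
    rintro w rfl rfl
    rw [map_map]
    exact le_Txi 𝒯 r _ _ _ (fun p => le_rfl) w
  · rw [Txi_le_iff]
    rintro w hw rfl
    obtain ⟨w', rfl, rfl⟩ := exists_lift 𝒯 f Prod.fst t w hw.symm
    rw [map_map, map_map]
    exact le_Txi 𝒯 (fun x y => r (f x) y) _ _ _ (fun p => by rw [p.2]) w'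

theorem Txi_map_right (g : Y → Y') (r : X → Y' → V) (t : 𝒯.T.obj X) (s : 𝒯.T.obj Y) :
    Txi 𝒯 (fun x y => r x (g y)) t s = Txi 𝒯 r t (𝒯.map g s) := by
  apply le_antisymm
  · rw [Txi_le_iff]
    rintro w rfl rfl
    rw [map_map]
    exact le_Txi 𝒯 r _ _ _ (fun p => le_rfl) w
  · rw [Txi_le_iff]
    rintro w rfl hw
    obtain ⟨w', rfl, rfl⟩ := exists_lift 𝒯 g Prod.snd s w hw.symm
    rw [map_map, map_map]
    exact le_Txi 𝒯 (fun x y => r x (g y)) _ _ _ (fun p => by rw [p.2]) w'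

theorem ξ_mul_apply (φ ψ : W → V) (w : 𝒯.T.obj W) :
    𝒯.ξ (𝒯.map (fun x => φ x * ψ x) w) = 𝒯.ξ (𝒯.map φ w) * 𝒯.ξ (𝒯.map ψ w) := by
  have h := 𝒯.ξ_tensor (𝒯.map (fun x => (φ x, ψ x)) w)
  simpa only [map_map] using h

theorem ξ_map_ξ (φ : W → V) (w : 𝒯.T.obj (𝒯.T.obj W)) :
    𝒯.ξ (𝒯.map (fun x => 𝒯.ξ (𝒯.map φ x)) w) = 𝒯.ξ (𝒯.map φ (𝒯.m W w)) := by
  have h := 𝒯.ξ_mul (𝒯.map (𝒯.map φ) w)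
  rw [map_m]
  exact (congrArg 𝒯.ξ (map_map 𝒯 (𝒯.map φ) 𝒯.ξ w)).symm.trans h

/-- Two witnesses that agree in `T Y` are glued over the pullback of the projections to `Y`, and `ξ`
is multiplicative. -/
theorem Txi_mul_le (r : X → Y → V) (s : Y → Z → V) (x : 𝒯.T.obj X) (y : 𝒯.T.obj Y)
    (z : 𝒯.T.obj Z) : Txi 𝒯 r x y * Txi 𝒯 s y z ≤ Txi 𝒯 (relComp s r) x z := by
  rw [← Quantale.leftMulResiduation_le_iff_mul_le, Txi_le_iff]
  rintro w₁ rfl rfl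
  rw [Quantale.leftMulResiduation_le_iff_mul_le, ← Quantale.rightMulResiduation_le_iff_mul_le,
    Txi_le_iff]
  rintro w₂ hw rfl
  rw [Quantale.rightMulResiduation_le_iff_mul_le]
  obtain ⟨w, rfl, rfl⟩ := exists_lift 𝒯 Prod.snd Prod.fst w₁ w₂ hw.symm
  rw [map_map, map_map, map_map, map_map, ← ξ_mul_apply]
  exact le_Txi 𝒯 (relComp s r) _ _ _
    (fun p => le_iSup_of_le p.1.1.2 (by rw [p.2])) w

/-- The nontrivial inequality `≤` holds because the composite is the direct image of `r ⊗ s` along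
`X × Y × Z → X × Z`, so `ξ_natural` applies. -/
theorem Txi_relComp (r : X → Y → V) (s : Y → Z → V) :
    Txi 𝒯 (relComp s r) = relComp (Txi 𝒯 s) (Txi 𝒯 r) := by
  funext x z
  apply le_antisymm
  · rw [Txi_le_iff]
    rintro w rfl rfl
    have key : (fun p : X × Z => relComp s r p.1 p.2) =
        fun p => ⨆ (a : X × Y × Z) (_ : (a.1, a.2.2) = p), r a.1 a.2.1 * s a.2.1 a.2.2 := by
      funext p
      apply le_antisymm
      · exact iSup_le fun y => le_iSup₂_of_le (p.1, y, p.2) rfl le_rfl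
      · refine iSup₂_le fun a h => ?_
        subst h
        exact le_iSup_of_le a.2.1 le_rfl
    rw [key]
    refine (𝒯.ξ_natural (fun a : X × Y × Z => (a.1, a.2.2))
      (fun a => r a.1 a.2.1 * s a.2.1 a.2.2) w).le.trans (iSup₂_le fun a h => ?_)
    change 𝒯.map _ a = w at h
    subst h
    rw [map_map, map_map]
    refine (ξ_mul_apply 𝒯 (fun a : X × Y × Z => r a.1 a.2.1) (fun a => s a.2.1 a.2.2) a).le.trans
      (le_iSup_of_le (𝒯.map (fun a : X × Y × Z => a.2.1) a) (mul_le_mul' ?_ ?_))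
    · exact le_Txi 𝒯 r (fun a : X × Y × Z => a.1) _ _ (fun _ => le_rfl) a
    · exact le_Txi 𝒯 s (fun a : X × Y × Z => a.2.1) (fun a => a.2.2) _ (fun _ => le_rfl) a
  · exact iSup_le fun y => Txi_mul_le 𝒯 r s x y z

theorem Txi_directImage (f : X → X') (r : X → Y → V) (t : 𝒯.T.obj X') (s : 𝒯.T.obj Y) :
    Txi 𝒯 (fun x' y => ⨆ (x : X) (_ : f x = x'), r x y) t s =
      ⨆ (t' : 𝒯.T.obj X) (_ : 𝒯.map f t' = t), Txi 𝒯 r t' s := by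
  apply le_antisymm
  · rw [Txi_le_iff]
    rintro w rfl rfl
    have key : (fun p : X' × Y => ⨆ (x : X) (_ : f x = p.1), r x p.2) =
        fun p => ⨆ (a : X × Y) (_ : (f a.1, a.2) = p), r a.1 a.2 := by
      funext p
      apply le_antisymm
      · exact iSup₂_le fun x h => le_iSup₂_of_le (x, p.2) (Prod.ext h rfl) le_rfl
      · refine iSup₂_le fun a h => ?_
        subst h
        exact le_iSup₂_of_le a.1 rfl le_rfl
    rw [key]
    refine (𝒯.ξ_natural (fun a : X × Y => (f a.1, a.2)) (fun a => r a.1 a.2) w).le.trans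
      (iSup₂_le fun a h => ?_)
    change 𝒯.map _ a = w at h
    subst h
    refine le_iSup₂_of_le (𝒯.map Prod.fst a) (by rw [map_map, map_map]) ?_
    rw [map_map]
    exact le_Txi 𝒯 r _ _ _ (fun _ => le_rfl) a
  · refine iSup₂_le fun t' h => ?_
    subst h
    refine le_trans (Txi_mono 𝒯 (r' := fun x y => ⨆ (x₁ : X) (_ : f x₁ = f x), r x₁ y)
      (fun x y => ?_) t' s)
      (Txi_map_left 𝒯 f (fun x' y => ⨆ (x : X) (_ : f x = x'), r x y) t' s).le
    exact le_iSup₂_of_le (f := fun x₁ (_ : f x₁ = f x) => r x₁ y) x rfl le_rfl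

theorem Txi_Txi_le (r : X → Y → V) (t : 𝒯.T.obj (𝒯.T.obj X)) (s : 𝒯.T.obj (𝒯.T.obj Y)) :
    Txi 𝒯 (Txi 𝒯 r) t s ≤ Txi 𝒯 r (𝒯.m X t) (𝒯.m Y s) := by
  rw [Txi_le_iff]
  rintro w rfl rfl
  have key : (fun p : 𝒯.T.obj X × 𝒯.T.obj Y => Txi 𝒯 r p.1 p.2) =
      fun p => ⨆ (a : 𝒯.T.obj (X × Y)) (_ : (𝒯.map Prod.fst a, 𝒯.map Prod.snd a) = p),
        𝒯.ξ (𝒯.map (fun p : X × Y => r p.1 p.2) a) := by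
    funext p
    simp only [Txi, Prod.ext_iff, iSup_and]
  rw [key]
  refine (𝒯.ξ_natural (fun a : 𝒯.T.obj (X × Y) => (𝒯.map Prod.fst a, 𝒯.map Prod.snd a))
    (fun a => 𝒯.ξ (𝒯.map (fun p : X × Y => r p.1 p.2) a)) w).le.trans (iSup₂_le fun a h => ?_)
  change 𝒯.map _ a = w at h
  subst h
  rw [map_map, map_map]
  refine (ξ_map_ξ 𝒯 _ a).le.trans
    ((le_Txi 𝒯 r Prod.fst Prod.snd _ (fun _ => le_rfl) (𝒯.m _ a)).trans_eq ?_)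
  rw [map_m, map_m]

/-- Here the weak pullback condition on `m` enters: a witness over `m s` is lifted to `T T (X × Y)`
through the naturality square at the second projection. -/
theorem iSup_Txi_Txi (r : X → Y → V) (t : 𝒯.T.obj X) (s : 𝒯.T.obj (𝒯.T.obj Y)) :
    ⨆ (t' : 𝒯.T.obj (𝒯.T.obj X)) (_ : 𝒯.m X t' = t), Txi 𝒯 (Txi 𝒯 r) t' s =
      Txi 𝒯 r t (𝒯.m Y s) := by
  apply le_antisymm
  · refine iSup₂_le fun t' h => ?_
    subst h
    exact Txi_Txi_le 𝒯 r t' s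
  · rw [Txi_le_iff]
    rintro w rfl h
    obtain ⟨a, rfl, rfl⟩ := exists_m_lift 𝒯 Prod.snd w s h
    refine le_iSup₂_of_le (𝒯.map (𝒯.map Prod.fst) a) (map_m 𝒯 _ _).symm ?_
    refine le_trans (le_of_eq ?_) (le_Txi 𝒯 (Txi 𝒯 r) (𝒯.map Prod.fst) (𝒯.map Prod.snd)
      (fun p => 𝒯.ξ (𝒯.map (fun p : X × Y => r p.1 p.2) p))
      (fun p => le_Txi 𝒯 r _ _ _ (fun _ => le_rfl) p) a)
    exact (ξ_map_ξ 𝒯 _ a).symm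

/-! ### The Kleisli convolution -/

theorem Txi_le_TxiM (α : 𝒯.T.obj X → Y → V) (t : 𝒯.T.obj (𝒯.T.obj X)) (y : 𝒯.T.obj Y) :
    Txi 𝒯 α t y ≤ TxiM 𝒯 α (𝒯.m X t) y :=
  le_iSup₂_of_le t rfl le_rfl

theorem TxiM_le_iff (α : 𝒯.T.obj X → Y → V) (y : 𝒯.T.obj Y) (φ : 𝒯.T.obj X → V) :
    (∀ x, TxiM 𝒯 α x y ≤ φ x) ↔ ∀ t, Txi 𝒯 α t y ≤ φ (𝒯.m X t) := by
  constructor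
  · exact fun h t => (Txi_le_TxiM 𝒯 α t y).trans (h _)
  · refine fun h x => iSup₂_le fun t ht => ?_
    subst ht
    exact h t

theorem TxiM_mono {α β : 𝒯.T.obj X → Y → V} (h : ∀ x y, α x y ≤ β x y) (x : 𝒯.T.obj X)
    (y : 𝒯.T.obj Y) : TxiM 𝒯 α x y ≤ TxiM 𝒯 β x y :=
  iSup₂_mono fun _ _ => Txi_mono 𝒯 h _ _

theorem le_TxiM_e (α : 𝒯.T.obj X → Y → V) (x : 𝒯.T.obj X) (y : Y) :
    α x y ≤ TxiM 𝒯 α x (𝒯.e Y y) :=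
  le_iSup₂_of_le (𝒯.e _ x) (m_e 𝒯 x) (le_Txi_e 𝒯 α x y)

theorem TxiM_map_right (g : Y → Y') (α : 𝒯.T.obj X → Y' → V) (x : 𝒯.T.obj X)
    (y : 𝒯.T.obj Y) :
    TxiM 𝒯 (fun x y => α x (g y)) x y = TxiM 𝒯 α x (𝒯.map g y) := by
  simp only [TxiM, Txi_map_right]

theorem TxiM_TxiM (α : 𝒯.T.obj X → Y → V) (x : 𝒯.T.obj X) (y : 𝒯.T.obj (𝒯.T.obj Y)) :
    TxiM 𝒯 (TxiM 𝒯 α) x y = TxiM 𝒯 α x (𝒯.m Y y) := by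
  have h : ∀ t, Txi 𝒯 (TxiM 𝒯 α) t y =
      ⨆ (t' : 𝒯.T.obj (𝒯.T.obj (𝒯.T.obj X))) (_ : 𝒯.map (𝒯.m X) t' = t),
        Txi 𝒯 (Txi 𝒯 α) t' y := fun t => Txi_directImage 𝒯 (𝒯.m X) (Txi 𝒯 α) t y
  apply le_antisymm
  · refine iSup₂_le fun t ht => ?_
    rw [h]
    refine iSup₂_le fun t' ht' => ?_
    subst ht ht'
    rw [m_map_m]
    exact (Txi_Txi_le 𝒯 α t' y).trans (Txi_le_TxiM 𝒯 α _ _)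
  · refine iSup₂_le fun t ht => ?_
    rw [← iSup_Txi_Txi]
    refine iSup₂_le fun t' ht' => ?_
    subst ht ht'
    refine le_iSup₂_of_le (𝒯.map (𝒯.m X) t') (m_map_m 𝒯 t') ?_
    rw [h]
    exact le_iSup₂_of_le t' rfl le_rfl

/-- `T_ξ (-) · m°` turns convolution into ordinary composition of relations, which reduces
associativity to that of relations. The middle point is moved along `m` by `TxiM_TxiM`. -/
theorem TxiM_kleisli (α : 𝒯.T.obj X → Y → V) (β : 𝒯.T.obj Y → Z → V) :
    TxiM 𝒯 (kleisli 𝒯 β α) = relComp (TxiM 𝒯 β) (TxiM 𝒯 α) := by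
  funext x z
  apply le_antisymm
  · refine iSup₂_le fun t ht => ?_
    subst ht
    rw [kleisli, Txi_relComp]
    refine iSup_le fun y => ?_
    refine le_iSup_of_le (𝒯.m Y y) (mul_le_mul' ?_ (Txi_le_TxiM 𝒯 β y z))
    rw [← TxiM_TxiM]
    exact Txi_le_TxiM 𝒯 _ t y
  · refine iSup_le fun y => ?_
    rw [← Quantale.rightMulResiduation_le_iff_mul_le]
    refine iSup₂_le fun y' hy => ?_
    subst hy
    rw [Quantale.rightMulResiduation_le_iff_mul_le, ← TxiM_TxiM,
      ← Quantale.leftMulResiduation_le_iff_mul_le]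
    refine iSup₂_le fun t ht => ?_
    subst ht
    rw [Quantale.leftMulResiduation_le_iff_mul_le]
    exact (Txi_mul_le 𝒯 _ _ t y' z).trans (Txi_le_TxiM 𝒯 (kleisli 𝒯 β α) t z)

theorem kleisli_assoc (α : 𝒯.T.obj X → Y → V) (β : 𝒯.T.obj Y → Z → V)
    (γ : 𝒯.T.obj Z → W → V) :
    kleisli 𝒯 γ (kleisli 𝒯 β α) = kleisli 𝒯 (kleisli 𝒯 γ β) α := by
  have h : ∀ {A B C D : Type u} (r : A → B → V) (s : B → C → V) (t : C → D → V),
      relComp t (relComp s r) = relComp (relComp t s) r := by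
    intro A B C D r s t
    funext a d
    simp only [relComp, Quantale.iSup_mul_distrib, Quantale.mul_iSup_distrib, mul_assoc]
    exact iSup_comm
  rw [kleisli, TxiM_kleisli, h]
  rfl

theorem kleisli_mono {β β' : 𝒯.T.obj Y → Z → V} {α α' : 𝒯.T.obj X → Y → V} (hβ : β ≤ β')
    (hα : α ≤ α') : kleisli 𝒯 β α ≤ kleisli 𝒯 β' α' :=
  fun x z => iSup_mono fun y => mul_le_mul' (TxiM_mono 𝒯 hα x y) (hβ y z)

theorem kleisli_le_iff_forall (β : 𝒯.T.obj Y → Z → V) (α : 𝒯.T.obj X → Y → V)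
    (γ : 𝒯.T.obj X → Z → V) : kleisli 𝒯 β α ≤ γ ↔
      ∀ t y z, Txi 𝒯 α t y * β y z ≤ γ (𝒯.m X t) z := by
  constructor
  · exact fun h t y z =>
      (mul_le_mul_left (Txi_le_TxiM 𝒯 α t y) _).trans ((le_iSup_of_le y le_rfl).trans (h _ z))
  · refine fun h x z => iSup_le fun y => ?_
    rw [← Quantale.leftMulResiduation_le_iff_mul_le]
    refine iSup₂_le fun t ht => ?_
    subst ht
    rw [Quantale.leftMulResiduation_le_iff_mul_le]
    exact h t y z

theorem le_kleisliExt_apply_iff (γ : 𝒯.T.obj X → Z → V) (α : 𝒯.T.obj X → Y → V)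
    (y : 𝒯.T.obj Y) (z : Z) (v : V) :
    v ≤ kleisliExt 𝒯 γ α y z ↔ ∀ x, TxiM 𝒯 α x y * v ≤ γ x z := by
  simp only [kleisliExt, relExt, le_iInf_iff, Quantale.leftMulResiduation_le_iff_mul_le, mul_comm]

theorem TCat.kleisli_str_le (X : TCat 𝒯) : kleisli 𝒯 X.str X.str ≤ X.str :=
  (kleisli_le_iff_forall 𝒯 _ _ _).2 X.trans

end Relations

/-! ### Presheaves as the free cocompletion of a `T`-category. -/

section Presheaves

variable {V : Type u} [CommMonoid V] [CompleteLattice V] [IsQuantale V] {𝒯 : TopologicalTheory V}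

/-! ### Modules, order and adjunctions -/

theorem ξ_map_one {X : Type u} (t : 𝒯.T.obj X) : 𝒯.ξ (𝒯.map (fun _ : X => (1 : V)) t) = 1 :=
  (congrArg 𝒯.ξ (map_map 𝒯 (fun _ : X => PUnit.unit.{u + 1}) (fun _ => (1 : V)) t)).symm.trans
    (𝒯.ξ_one _)

theorem one_le_Txi {X Y W : Type u} (r : X → Y → V) (p : W → X) (q : W → Y)
    (h : ∀ w, 1 ≤ r (p w) (q w)) (w : 𝒯.T.obj W) : 1 ≤ Txi 𝒯 r (𝒯.map p w) (𝒯.map q w) :=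
  (ξ_map_one w).ge.trans (le_Txi 𝒯 r p q _ h w)

theorem TCat.one_le_TxiM_str (X : TCat 𝒯) (t : 𝒯.T.obj X.carrier) : 1 ≤ TxiM 𝒯 X.str t t := by
  have h := (one_le_Txi X.str (𝒯.e X.carrier) (fun x => x) X.refl t).trans (Txi_le_TxiM 𝒯 _ _ _)
  rwa [m_map_e, map_id_apply] at h

theorem TxiM_mul_le_of_kleisli_le {X Y Z : Type u} {α : 𝒯.T.obj X → Y → V}
    {β : 𝒯.T.obj Y → Z → V} {γ : 𝒯.T.obj X → Z → V} (h : kleisli 𝒯 β α ≤ γ) (x : 𝒯.T.obj X)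
    (y : 𝒯.T.obj Y) (z : Z) : TxiM 𝒯 α x y * β y z ≤ γ x z :=
  (le_iSup (fun y => TxiM 𝒯 α x y * β y z) y).trans (h x z)

theorem TFunctor.Txi_le {X Y : TCat 𝒯} (f : TFunctor X Y) (t : 𝒯.T.obj (𝒯.T.obj X.carrier))
    (s : 𝒯.T.obj X.carrier) :
    Txi 𝒯 X.str t s ≤ Txi 𝒯 Y.str (𝒯.map (𝒯.map f.toFun) t) (𝒯.map f.toFun s) :=
  (Txi_mono 𝒯 f.str_le t s).trans_eq
    ((Txi_map_left 𝒯 (𝒯.map f.toFun) (fun t x => Y.str t (f.toFun x)) t s).trans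
      (Txi_map_right 𝒯 f.toFun Y.str _ s))

theorem TFunctor.lowerStar_isModule {X Y : TCat 𝒯} (f : TFunctor X Y) :
    IsModule X Y f.lowerStar := by
  constructor
  · rw [kleisli_le_iff_forall]
    intro t s y
    refine (mul_le_mul_left (f.Txi_le t s) _).trans ((Y.trans _ _ _).trans_eq ?_)
    rw [TFunctor.lowerStar, map_m]
  · rw [kleisli_le_iff_forall]
    intro t s y
    refine (mul_le_mul_left (Txi_map_left 𝒯 (𝒯.map f.toFun) Y.str t s).le _).trans
      ((Y.trans _ _ _).trans_eq ?_)
    rw [TFunctor.lowerStar, map_m]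

theorem TFunctor.str_map_le_of_le {X Y : TCat 𝒯} {f g : TFunctor X Y} (h : f ≤ g)
    (t : 𝒯.T.obj X.carrier) (y : Y.carrier) :
    Y.str (𝒯.map g.toFun t) y ≤ Y.str (𝒯.map f.toFun t) y := by
  have h₁ := one_le_Txi Y.str (fun x => 𝒯.e _ (f.toFun x)) g.toFun ((TFunctor.le_iff f g).1 h) t
  calc Y.str (𝒯.map g.toFun t) y = 1 * Y.str (𝒯.map g.toFun t) y := (one_mul _).symm
    _ ≤ _ := mul_le_mul_left h₁ _
    _ ≤ _ := Y.trans _ _ _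
    _ = _ := by rw [← map_map 𝒯 f.toFun (𝒯.e _), m_map_e]

/-- Unit and counit are traded for the hom form `f_* = g^*`, the form in which adjunctions are used
in most of what follows. -/
theorem TFunctor.isLeftAdjoint_iff {X Y : TCat 𝒯} (f : TFunctor X Y) :
    f.IsLeftAdjoint ↔ ∃ g : TFunctor Y X, ∀ t y,
      Y.str (𝒯.map f.toFun t) y = X.str t (g.toFun y) := by
  constructor
  · rintro ⟨g, h₁, h₂⟩
    refine ⟨g, fun t y => le_antisymm ?_ ?_⟩
    · refine (g.str_le _ y).trans ?_
      rw [map_map]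
      refine (TFunctor.str_map_le_of_le h₁ t (g.toFun y)).trans_eq ?_
      exact congrArg (fun s => X.str s (g.toFun y)) (map_id_apply 𝒯 t)
    · exact (f.str_le t (g.toFun y)).trans (h₂ _ y)
  · rintro ⟨g, h⟩
    refine ⟨g, (TFunctor.le_iff _ _).2 fun x => ?_, (TFunctor.le_iff _ _).2 fun y => ?_⟩
    · change 1 ≤ X.str (𝒯.e _ x) (g.toFun (f.toFun x))
      rw [← h, map_e]
      exact Y.refl _
    · change 1 ≤ Y.str (𝒯.e _ (f.toFun (g.toFun y))) y
      rw [← map_e, h]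
      exact X.refl _

/-- Points are `T`-functors from the discrete one-point category, so separatedness is antisymmetry
of the underlying `V`-category. -/
theorem isLSeparated_iff (X : TCat 𝒯) : IsLSeparated X ↔
    ∀ x y, 1 ≤ X.str (𝒯.e _ x) y → 1 ≤ X.str (𝒯.e _ y) x → x = y := by
  constructor
  · intro hX x y hxy hyx
    let pt : X.carrier → TFunctor (TCat.discrete 𝒯 PUnit.{u + 1}) X := fun x =>
      { toFun := fun _ => x
        str_le := fun t z => iSup_le fun h => by
          subst h
          refine (X.refl x).trans (le_of_eq ?_)
          exact congrArg (fun s => X.str s x) (map_e 𝒯 (fun _ : PUnit.{u + 1} => x) z).symm }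
    exact congrFun (congrArg TFunctor.toFun (hX _ (pt x) (pt y)
      ((TFunctor.le_iff _ _).2 fun _ => hxy) ((TFunctor.le_iff _ _).2 fun _ => hyx))) PUnit.unit
  · intro h Y f g hfg hgf
    rw [TFunctor.le_iff] at hfg hgf
    ext x
    exact h _ _ (hfg x) (hgf x)

theorem TFunctor.eq_of_lowerStar_eq {X Y : TCat 𝒯} (hY : IsLSeparated Y) {f g : TFunctor X Y}
    (h : f.lowerStar = g.lowerStar) : f = g := by
  have h' : ∀ x y, Y.str (𝒯.e _ (f.toFun x)) y = Y.str (𝒯.e _ (g.toFun x)) y := by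
    intro x y
    have := congrFun (congrFun h (𝒯.e _ x)) y
    simpa only [TFunctor.lowerStar, map_e] using this
  exact hY X f g ((TFunctor.le_iff _ _).2 fun x => (h' _ _).ge.trans' (Y.refl _))
    ((TFunctor.le_iff _ _).2 fun x => (h' _ _).le.trans' (Y.refl _))

/-! ### The `T`-category of presheaves -/

theorem Txi_e_right {X Y : Type u} (r : X → Y → V) (t : 𝒯.T.obj X) (y : Y) :
    Txi 𝒯 r t (𝒯.e Y y) = Txi 𝒯 (fun x (_ : PUnit.{u + 1}) => r x y) t (𝒯.e _ PUnit.unit) := by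
  rw [Txi_map_right 𝒯 (fun _ : PUnit.{u + 1} => y) r, map_e]

/-- The modules from the `T`-category `X` to the one-point discrete `T`-category. -/
def Presheaf (X : TCat 𝒯) : Type u :=
  {ψ : 𝒯.T.obj X.carrier → V // (∀ t s, Txi 𝒯 X.str t s * ψ s ≤ ψ (𝒯.m _ t)) ∧
    ∀ t, Txi 𝒯 (fun s (_ : PUnit.{u + 1}) => ψ s) t (𝒯.e _ PUnit.unit) ≤ ψ (𝒯.m _ t)}

/-- The evaluation, as a `T`-relation from `X` to its presheaves. -/
def Presheaf.ev (X : TCat 𝒯) : 𝒯.T.obj X.carrier → Presheaf X → V :=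
  fun t ψ => ψ.1 t

/-- The second defining condition of a presheaf is what gives `≤`. It makes the underlying
`V`-category of `X.psh` carry the pointwise hom. -/
theorem Presheaf.TxiM_ev_e {X : TCat 𝒯} (t : 𝒯.T.obj X.carrier) (ψ : Presheaf X) :
    TxiM 𝒯 (Presheaf.ev X) t (𝒯.e _ ψ) = ψ.1 t := by
  refine le_antisymm ?_ (le_TxiM_e 𝒯 (Presheaf.ev X) t ψ)
  refine (TxiM_le_iff 𝒯 _ _ ψ.1).2 (fun s => ?_) t
  rw [Txi_e_right]
  exact ψ.2.2 s

/-- The `T`-category of presheaves on `X`. -/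
def TCat.psh (X : TCat 𝒯) : TCat 𝒯 where
  carrier := Presheaf X
  str := kleisliExt 𝒯 (Presheaf.ev X) (Presheaf.ev X)
  refl := fun ψ => by
    rw [le_kleisliExt_apply_iff]
    intro t
    rw [Presheaf.TxiM_ev_e, mul_one]
    rfl
  trans := by
    -- With `R = ev / ev`, the claim `R ∘ R ≤ R` transposes to `R ∘ (R ∘ ev) ≤ ev`, which is the
    -- counit `R ∘ ev ≤ ev` used twice.
    rw [← kleisli_le_iff_forall, ← kleisli_le_iff, ← kleisli_assoc]
    have h := (kleisli_le_iff 𝒯 (kleisliExt 𝒯 (Presheaf.ev X) (Presheaf.ev X)) _ _).2 le_rfl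
    exact (kleisli_mono 𝒯 le_rfl h).trans h

theorem TCat.psh_str_e (X : TCat 𝒯) (ψ φ : Presheaf X) (v : V) :
    v ≤ X.psh.str (𝒯.e (Presheaf X) ψ) φ ↔ ∀ t, ψ.1 t * v ≤ φ.1 t := by
  refine (le_kleisliExt_apply_iff 𝒯 (Presheaf.ev X) (Presheaf.ev X) (𝒯.e (Presheaf X) ψ) φ
    v).trans (forall_congr' fun t => ?_)
  rw [Presheaf.TxiM_ev_e]
  rfl

theorem TCat.psh_isLSeparated (X : TCat 𝒯) : IsLSeparated X.psh := by
  rw [isLSeparated_iff]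
  intro ψ φ h₁ h₂
  replace h₁ := (X.psh_str_e ψ φ 1).1 h₁
  replace h₂ := (X.psh_str_e φ ψ 1).1 h₂
  simp only [mul_one] at h₁ h₂
  exact Subtype.ext (funext fun t => le_antisymm (h₁ t) (h₂ t))

theorem Presheaf.ev_isModule (X : TCat 𝒯) : IsModule X X.psh (Presheaf.ev X) :=
  ⟨(kleisli_le_iff_forall 𝒯 _ _ _).2 fun t s ψ => ψ.2.1 t s, (kleisli_le_iff 𝒯 _ _ _).2 le_rfl⟩

/-- The `T`-functor into presheaves that corresponds to a module. -/
def IsModule.name {X Z : TCat 𝒯} {α : 𝒯.T.obj X.carrier → Z.carrier → V} (hα : IsModule X Z α) :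
    TFunctor Z X.psh where
  toFun := fun z => ⟨fun t => α t z, fun t s => (kleisli_le_iff_forall 𝒯 _ _ _).1 hα.1 t s z,
    fun t => by
      rw [← Txi_e_right]
      calc Txi 𝒯 α t (𝒯.e _ z) = Txi 𝒯 α t (𝒯.e _ z) * 1 := (mul_one _).symm
        _ ≤ Txi 𝒯 α t (𝒯.e _ z) * Z.str (𝒯.e _ z) z := mul_le_mul_right (Z.refl z) _
        _ ≤ α (𝒯.m _ t) z := (kleisli_le_iff_forall 𝒯 _ _ _).1 hα.2 t _ z⟩
  str_le := fun t z => by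
    refine (le_kleisliExt_apply_iff 𝒯 _ _ _ _ _).2 fun x => ?_
    refine le_trans (mul_le_mul_left (TxiM_map_right 𝒯 _ (Presheaf.ev X) x t).ge _) ?_
    exact TxiM_mul_le_of_kleisli_le hα.2 x t z

/-- The `T`-relation that corresponds to a map into presheaves. -/
def TFunctor.uncurry {X Z : TCat 𝒯} (f : TFunctor Z X.psh) :
    𝒯.T.obj X.carrier → Z.carrier → V :=
  fun t z => (f.toFun z).1 t

theorem TFunctor.TxiM_uncurry {X Z : TCat 𝒯} (f : TFunctor Z X.psh) (t : 𝒯.T.obj X.carrier)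
    (z : 𝒯.T.obj Z.carrier) :
    TxiM 𝒯 f.uncurry t z = TxiM 𝒯 (Presheaf.ev X) t (𝒯.map f.toFun z) :=
  TxiM_map_right 𝒯 f.toFun (Presheaf.ev X) t z

theorem TFunctor.lowerStar_psh {X Z : TCat 𝒯} (f : TFunctor Z X.psh) :
    f.lowerStar = kleisliExt 𝒯 (Presheaf.ev X) f.uncurry := by
  funext z φ
  simp only [kleisliExt, relExt, TxiM_uncurry]
  rfl

theorem TFunctor.uncurry_isModule {X Z : TCat 𝒯} (f : TFunctor Z X.psh) :
    IsModule X Z f.uncurry := by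
  refine ⟨(kleisli_le_iff_forall 𝒯 _ _ _).2 fun t s z => (f.toFun z).2.1 t s, ?_⟩
  refine fun t z => iSup_le fun s => ?_
  rw [TxiM_uncurry]
  exact (mul_le_mul_right (f.str_le s z) _).trans
    (TxiM_mul_le_of_kleisli_le (Presheaf.ev_isModule X).2 t _ _)

theorem IsModule.kleisli {X Y Z : TCat 𝒯} {β : 𝒯.T.obj Y.carrier → Z.carrier → V}
    {α : 𝒯.T.obj X.carrier → Y.carrier → V} (hβ : IsModule Y Z β) (hα : IsModule X Y α) :
    IsModule X Z (kleisli 𝒯 β α) := by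
  constructor
  · rw [← kleisli_assoc]
    exact kleisli_mono 𝒯 le_rfl hα.1
  · rw [kleisli_assoc]
    exact kleisli_mono 𝒯 hβ.2 le_rfl

/-- The colimit of `h` weighted by `χ` is the name of `χ ∘ h.uncurry`, because `(ev / α) / χ = ev /
(χ ∘ α)`. -/
theorem TCat.psh_isCocomplete (X : TCat 𝒯) : IsCocomplete X.psh := by
  intro Y Z h χ hχ
  refine ⟨(hχ.kleisli h.uncurry_isModule).name, ?_⟩
  rw [IsWeightedColimit, TFunctor.lowerStar_psh, TFunctor.lowerStar_psh]
  refine eq_of_forall_le_iff fun γ => ?_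
  refine (kleisli_le_iff 𝒯 _ _ _).symm.trans ((kleisli_le_iff 𝒯 _ _ _).symm.trans ?_)
  rw [← kleisli_assoc]
  exact kleisli_le_iff 𝒯 γ (kleisli 𝒯 χ h.uncurry) (Presheaf.ev X)

/-! ### The Yoneda embedding and the universal property of presheaves -/

theorem TCat.str_isModule (X : TCat 𝒯) : IsModule X X X.str :=
  ⟨X.kleisli_str_le, X.kleisli_str_le⟩

/-- The Yoneda embedding. -/
def TCat.yoneda (X : TCat 𝒯) : TFunctor X X.psh := X.str_isModule.name

/-- The Yoneda lemma: over representables evaluation becomes `X.str`. Reflexivity gives `≤`, and the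
action of `X.str` on `γ` gives `≥`. -/
theorem TCat.kleisliExt_yoneda (X : TCat 𝒯) {Z : Type u} {γ : 𝒯.T.obj X.carrier → Z → V}
    (hγ : kleisli 𝒯 γ X.str ≤ γ) (t : 𝒯.T.obj X.carrier) (z : Z) :
    kleisliExt 𝒯 γ (Presheaf.ev X) (𝒯.map X.yoneda.toFun t) z = γ t z := by
  have h : ∀ s, TxiM 𝒯 (Presheaf.ev X) s (𝒯.map X.yoneda.toFun t) = TxiM 𝒯 X.str s t :=
    fun s => (X.yoneda.TxiM_uncurry s t).symm
  apply le_antisymm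
  · have h₁ := (le_kleisliExt_apply_iff 𝒯 γ (Presheaf.ev X) (𝒯.map X.yoneda.toFun t) z _).1
      le_rfl t
    rw [h] at h₁
    refine le_trans ?_ h₁
    exact (one_mul _).ge.trans (mul_le_mul_left (X.one_le_TxiM_str t) _)
  · rw [le_kleisliExt_apply_iff]
    intro s
    rw [h]
    exact TxiM_mul_le_of_kleisli_le hγ s t z

theorem TCat.psh_str_yoneda (X : TCat 𝒯) (t : 𝒯.T.obj X.carrier) (ψ : Presheaf X) :
    X.psh.str (𝒯.map X.yoneda.toFun t) ψ = ψ.1 t :=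
  X.kleisliExt_yoneda (Presheaf.ev_isModule X).1 t ψ

/-- The extension is the colimit of `h` weighted by evaluation. Its right adjoint is the name of the
module `h_*`. -/
theorem exists_extension {X Y : TCat 𝒯} (hs : IsLSeparated Y) (hc : IsCocomplete Y)
    (h : TFunctor X Y) : ∃ k : TFunctor X.psh Y, k.IsLeftAdjoint ∧ k.comp X.yoneda = h := by
  obtain ⟨k, hk⟩ := hc X X.psh h (Presheaf.ev X) (Presheaf.ev_isModule X)
  have hk' : ∀ t y, Y.str (𝒯.map k.toFun t) y = kleisliExt 𝒯 h.lowerStar (Presheaf.ev X) t y :=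
    fun t y => (congrFun (congrFun hk t) y).symm
  refine ⟨k, k.isLeftAdjoint_iff.2 ⟨h.lowerStar_isModule.name, hk'⟩,
    TFunctor.eq_of_lowerStar_eq hs ?_⟩
  funext t y
  refine Eq.trans ?_ ((hk' (𝒯.map X.yoneda.toFun t) y).trans
    (X.kleisliExt_yoneda h.lowerStar_isModule.1 t y))
  rw [map_map]
  rfl

/-- If `k` is left adjoint to `g`, then `g` is the name of `(k · y)_*`, so `k_* = (k · y)_* / ev`
depends only on `k · y`. -/
theorem extension_unique {X Y : TCat 𝒯} (hs : IsLSeparated Y) {k l : TFunctor X.psh Y}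
    (hk : k.IsLeftAdjoint) (hl : l.IsLeftAdjoint) (h : k.comp X.yoneda = l.comp X.yoneda) :
    k = l := by
  have key : ∀ k : TFunctor X.psh Y, k.IsLeftAdjoint →
      k.lowerStar = kleisliExt 𝒯 (k.comp X.yoneda).lowerStar (Presheaf.ev X) := by
    intro k hk
    obtain ⟨g, hg⟩ := k.isLeftAdjoint_iff.1 hk
    have h₁ : ∀ t y, (k.comp X.yoneda).lowerStar t y = Presheaf.ev X t (g.toFun y) := by
      intro t y
      refine Eq.trans ?_ ((hg (𝒯.map X.yoneda.toFun t) y).trans (X.psh_str_yoneda t _))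
      rw [map_map]
      rfl
    funext t y
    refine (hg t y).trans ?_
    simp only [kleisliExt, relExt, h₁]
    rfl
  exact TFunctor.eq_of_lowerStar_eq hs ((key k hk).trans ((congrArg
    (fun f => kleisliExt 𝒯 (TFunctor.lowerStar f) (Presheaf.ev X)) h).trans (key l hl).symm))

end Presheaves

/-! ### Free `T`-categories on `V`-categories, followed by free cocompletion. -/

section LeftAdjoint

variable {V : Type u} [CommMonoid V] [CompleteLattice V] [IsQuantale V]

/-! ### The left adjoint of the forgetful functor -/

theorem TCat.v_trans (X : TCat (idTheory V)) (x y z : X.carrier) :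
    X.str x y * X.str y z ≤ X.str x z :=
  (mul_le_mul_left (Txi_idTheory X.str x y).ge _).trans (X.trans x y z)

/-- The free `T`-category `(X, e° · T_ξ r)` on a `V`-category `(X, r)`. -/
def TCat.free (𝒯 : TopologicalTheory V) (X : TCat (idTheory V)) : TCat 𝒯 where
  carrier := X.carrier
  str := fun t x => Txi 𝒯 (X := X.carrier) X.str t (𝒯.e X.carrier x)
  refl := fun x => (X.refl x).trans (le_Txi_e 𝒯 (X := X.carrier) X.str x x)
  trans := fun t s x => by
    rw [Txi_map_right 𝒯 (𝒯.e X.carrier) (Txi 𝒯 (X := X.carrier) X.str)]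
    refine (mul_le_mul_left (Txi_Txi_le 𝒯 (X := X.carrier) X.str t _) _).trans ?_
    rw [m_map_e]
    refine (Txi_mul_le 𝒯 (X := X.carrier) X.str X.str _ _ _).trans ?_
    exact Txi_mono 𝒯 (fun x z => iSup_le fun y => X.v_trans x y z) _ _

variable {𝒯 : TopologicalTheory V}

theorem TCat.Txi_toVCat_le (Y : TCat 𝒯) (t : 𝒯.T.obj Y.carrier) (s : 𝒯.T.obj Y.carrier)
    (y : Y.carrier) :
    Txi 𝒯 (X := Y.carrier) Y.toVCat.str t s * Y.str s y ≤ Y.str t y := by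
  refine (mul_le_mul_left (Txi_map_left 𝒯 (𝒯.e Y.carrier) Y.str t s).le _).trans
    ((Y.trans _ _ _).trans_eq ?_)
  rw [m_map_e]

/-- The identity map from the free `T`-category on `Y.toVCat` to `Y` is a `T`-functor: the counit
behind `freeEquiv`. -/
theorem TCat.Txi_toVCat_e_le (Y : TCat 𝒯) (t : 𝒯.T.obj Y.carrier) (y : Y.carrier) :
    Txi 𝒯 (X := Y.carrier) Y.toVCat.str t (𝒯.e _ y) ≤ Y.str t y :=
  (mul_one _).ge.trans ((mul_le_mul_right (Y.refl y) _).trans (Y.Txi_toVCat_le t _ y))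

/-- Transposition of `T`-functors on free `T`-categories. -/
def freeEquiv (X : TCat (idTheory V)) (Y : TCat 𝒯) :
    TFunctor (X.free 𝒯) Y ≃ TFunctor X Y.toVCat where
  toFun f :=
    { toFun := f.toFun
      str_le := fun x y => by
        refine (le_Txi_e 𝒯 (X := X.carrier) X.str x y).trans ((f.str_le (𝒯.e X.carrier x) y).trans
          (le_of_eq ?_))
        exact congrArg (fun s => Y.str s (f.toFun y)) (map_e 𝒯 f.toFun x) }
  invFun f :=
    { toFun := f.toFun
      str_le := fun t y => by
        refine le_trans ?_ (Y.Txi_toVCat_e_le _ _)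
        refine (Txi_mono 𝒯 (X := X.carrier) (r := X.str)
          (r' := fun x y => Y.toVCat.str (f.toFun x) (f.toFun y)) f.str_le t _).trans_eq ?_
        refine (Txi_map_left 𝒯 (X := X.carrier) f.toFun
          (fun x y => Y.toVCat.str x (f.toFun y)) _ _).trans ?_
        refine (Txi_map_right 𝒯 (Y := X.carrier) f.toFun Y.toVCat.str _ _).trans ?_
        exact congrArg (Txi 𝒯 (X := Y.carrier) Y.toVCat.str (𝒯.map f.toFun t))
          (map_e 𝒯 f.toFun y) }
  left_inv _ := rfl
  right_inv _ := rfl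

/-- The L-separated cocomplete `T`-category of presheaves on `X`. -/
def CocomplSep.psh (X : TCat 𝒯) : CocomplSep 𝒯 where
  obj := X.psh
  sep := X.psh_isLSeparated
  cocomplete := X.psh_isCocomplete

theorem CocomplSep.comp_yoneda_bijective (X : TCat 𝒯) (Y : CocomplSep 𝒯) :
    Function.Bijective fun k : CocomplSep.psh X ⟶ Y => k.fn.comp X.yoneda := by
  constructor
  · intro k l h
    exact CocomplSep.Hom.ext (extension_unique Y.sep k.isLeftAdjoint l.isLeftAdjoint h)
  · intro h
    obtain ⟨k, hk, hk'⟩ := exists_extension Y.sep Y.cocomplete h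
    exact ⟨⟨k, hk⟩, hk'⟩

/-- Left adjoint `T`-functors on the presheaves of a free `T`-category are `V`-functors. -/
noncomputable def pshFreeEquiv (X : CatSep (idTheory V)) (Y : CocomplSep 𝒯) :
    (CocomplSep.psh (X.obj.free 𝒯) ⟶ Y) ≃ (X ⟶ (forgetCocomplSep 𝒯).obj Y) :=
  (Equiv.ofBijective _ (CocomplSep.comp_yoneda_bijective (X.obj.free 𝒯) Y)).trans
    ((freeEquiv X.obj Y.obj).trans
      { toFun := fun f => ObjectProperty.homMk f
        invFun := fun f => f.hom
        left_inv := fun _ => rfl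
        right_inv := fun _ => rfl })

/-- Presheaves on free `T`-categories are left adjoint to the forgetful functor. -/
noncomputable def pshFreeAdjunction (𝒯 : TopologicalTheory V) :
    Adjunction.leftAdjointOfEquiv (G := forgetCocomplSep 𝒯) pshFreeEquiv (fun _ _ _ _ _ => rfl) ⊣
      forgetCocomplSep 𝒯 :=
  Adjunction.adjunctionOfEquivLeft _ _

end LeftAdjoint

/-! ### Representability of cocomplete `T`-categories, and structure on split quotients. -/

section Monadicity

variable {V : Type u} [CommMonoid V] [CompleteLattice V] [IsQuantale V] {𝒯 : TopologicalTheory V}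

/-! ### Cocomplete `T`-categories are representable -/

/-- A left adjoint on presheaves is computed from its restriction to representables, as a weighted
colimit. -/
theorem le_str_map_iff {X Y : TCat 𝒯} {k : TFunctor X.psh Y} (hk : k.IsLeftAdjoint)
    (p : 𝒯.T.obj (Presheaf X)) (y : Y.carrier) (v : V) :
    v ≤ Y.str (𝒯.map k.toFun p) y ↔ ∀ t, TxiM 𝒯 (Presheaf.ev X) t p * v ≤
      Y.str (𝒯.map (fun x => k.toFun (X.yoneda.toFun x)) t) y := by
  obtain ⟨g, hg⟩ := k.isLeftAdjoint_iff.1 hk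
  have h : ∀ t, Y.str (𝒯.map (fun x => k.toFun (X.yoneda.toFun x)) t) y = (g.toFun y).1 t := by
    intro t
    refine Eq.trans ?_ ((hg (𝒯.map X.yoneda.toFun t) y).trans (X.psh_str_yoneda t _))
    rw [map_map]
  simp only [h]
  exact (hg p y).symm ▸ le_kleisliExt_apply_iff 𝒯 (Presheaf.ev X) (Presheaf.ev X) p (g.toFun y) v

theorem le_str_e_iff {X Y : TCat 𝒯} {k : TFunctor X.psh Y} (hk : k.IsLeftAdjoint)
    (ψ : Presheaf X) (y : Y.carrier) (v : V) :
    v ≤ Y.str (𝒯.e _ (k.toFun ψ)) y ↔ ∀ t, ψ.1 t * v ≤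
      Y.str (𝒯.map (fun x => k.toFun (X.yoneda.toFun x)) t) y := by
  have h := le_str_map_iff hk (𝒯.e (Presheaf X) ψ) y v
  simp only [Presheaf.TxiM_ev_e] at h
  refine Iff.trans (Eq.to_iff ?_) h
  exact congrArg (fun s => v ≤ Y.str s y) (map_e 𝒯 k.toFun ψ).symm

/-- The presheaf represented by an element of `T X`. -/
def TCat.presheafOf (X : TCat 𝒯) (s : 𝒯.T.obj X.carrier) : Presheaf X :=
  ⟨fun t => TxiM 𝒯 X.str t s, by
    intro t r
    refine (mul_le_mul_left (Txi_le_TxiM 𝒯 X.str t r) _).trans ?_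
    have h : TxiM 𝒯 (kleisli 𝒯 X.str X.str) (𝒯.m _ t) s ≤ TxiM 𝒯 X.str (𝒯.m _ t) s :=
      TxiM_mono 𝒯 X.kleisli_str_le _ _
    rw [TxiM_kleisli] at h
    exact (le_iSup (fun r => TxiM 𝒯 X.str (𝒯.m _ t) r * TxiM 𝒯 X.str r s) r).trans h, by
    intro t
    rw [← Txi_e_right]
    refine (Txi_le_TxiM 𝒯 _ _ _).trans ?_
    rw [TxiM_TxiM, m_e]⟩

/-- With `k` the left adjoint of Yoneda, `σ s` is the colimit `k` of the presheaf `T_ξ a · m° (-,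
s)`. Applying `T_ξ · m°` to this family yields the same presheaf at `m t`, and Yoneda identifies the
result with `a (m t, -)`. -/
theorem exists_limitMap (Y : CocomplSep 𝒯) : ∃ σ : 𝒯.T.obj Y.obj.carrier → Y.obj.carrier,
    ∀ t z, Y.obj.str (𝒯.map σ t) z = Y.obj.str (𝒯.m _ t) z := by
  obtain ⟨k, hk, hk'⟩ := exists_extension Y.sep Y.cocomplete (TFunctor.id Y.obj)
  have hid : (fun x => k.toFun (Y.obj.yoneda.toFun x)) = fun x => x :=
    congrArg TFunctor.toFun hk'
  refine ⟨fun s => k.toFun (Y.obj.presheafOf s), fun t z => eq_of_forall_le_iff fun v => ?_⟩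
  have h₁ : v ≤ Y.obj.str (𝒯.map (fun s => k.toFun (Y.obj.presheafOf s)) t) z ↔
      ∀ s, TxiM 𝒯 Y.obj.str s (𝒯.m _ t) * v ≤ Y.obj.str s z := by
    have h := le_str_map_iff hk (𝒯.map Y.obj.presheafOf t) z v
    rw [hid] at h
    simp only [map_id_apply, ← TxiM_map_right] at h
    refine Iff.trans (Eq.to_iff ?_) (h.trans (forall_congr' fun s => ?_))
    · exact congrArg (fun s => v ≤ Y.obj.str s z) (map_map 𝒯 Y.obj.presheafOf k.toFun t).symm
    · rw [← TxiM_TxiM]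
      rfl
  rw [h₁]
  constructor
  · intro h
    exact (one_mul v).ge.trans ((mul_le_mul_left (Y.obj.one_le_TxiM_str _) v).trans (h _))
  · intro h s
    exact (mul_le_mul_right h _).trans (TxiM_mul_le_of_kleisli_le Y.obj.kleisli_str_le _ _ _)

/-- The map `T Y → Y` that represents the structure of a cocomplete `T`-category `Y`. -/
noncomputable def CocomplSep.lim (Y : CocomplSep 𝒯) : 𝒯.T.obj Y.obj.carrier → Y.obj.carrier :=
  (exists_limitMap Y).choose

theorem CocomplSep.str_map_lim (Y : CocomplSep 𝒯) (t : 𝒯.T.obj (𝒯.T.obj Y.obj.carrier))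
    (z : Y.obj.carrier) : Y.obj.str (𝒯.map Y.lim t) z = Y.obj.str (𝒯.m _ t) z :=
  (exists_limitMap Y).choose_spec t z

theorem CocomplSep.str_e_lim (Y : CocomplSep 𝒯) (t : 𝒯.T.obj Y.obj.carrier)
    (z : Y.obj.carrier) : Y.obj.str (𝒯.e _ (Y.lim t)) z = Y.obj.str t z := by
  have h := Y.str_map_lim (𝒯.e _ t) z
  rwa [map_e, m_e] at h

theorem CocomplSep.ext_of_str (Y : CocomplSep 𝒯) {x y : Y.obj.carrier}
    (h : ∀ z, Y.obj.str (𝒯.e _ x) z = Y.obj.str (𝒯.e _ y) z) : x = y :=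
  (isLSeparated_iff Y.obj).1 Y.sep x y ((h y).ge.trans' (Y.obj.refl y))
    ((h x).le.trans' (Y.obj.refl x))

theorem CocomplSep.lim_e (Y : CocomplSep 𝒯) (y : Y.obj.carrier) : Y.lim (𝒯.e _ y) = y :=
  Y.ext_of_str fun z => Y.str_e_lim _ z

theorem CocomplSep.lim_map_lim (Y : CocomplSep 𝒯) (t : 𝒯.T.obj (𝒯.T.obj Y.obj.carrier)) :
    Y.lim (𝒯.map Y.lim t) = Y.lim (𝒯.m _ t) :=
  Y.ext_of_str fun z => by rw [Y.str_e_lim, Y.str_e_lim, Y.str_map_lim]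

theorem CocomplSep.Hom.map_lim {X Y : CocomplSep 𝒯} (f : CocomplSep.Hom X Y)
    (t : 𝒯.T.obj X.obj.carrier) : f.fn.toFun (X.lim t) = Y.lim (𝒯.map f.fn.toFun t) := by
  obtain ⟨g, hg⟩ := f.fn.isLeftAdjoint_iff.1 f.isLeftAdjoint
  refine Y.ext_of_str fun z => ?_
  rw [← map_e, hg, X.str_e_lim, Y.str_e_lim, hg]

theorem CocomplSep.Txi_le_lim (Y : CocomplSep 𝒯) (t s : 𝒯.T.obj Y.obj.carrier) :
    Txi 𝒯 (X := Y.obj.carrier) Y.obj.toVCat.str t s ≤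
      Y.obj.str (𝒯.e _ (Y.lim t)) (Y.lim s) := by
  rw [Y.str_e_lim]
  refine le_trans ?_ (Y.obj.Txi_toVCat_le t s _)
  refine (mul_one _).ge.trans (mul_le_mul_right ?_ _)
  rw [← Y.str_e_lim]
  exact Y.obj.refl _

/-! ### Quotients of cocomplete `T`-categories -/

/-- A quotient of the underlying `V`-category of `Y`, split by a `V`-functor and compatible with
the representing map of `Y`. -/
structure SplitQuotient (Y : CocomplSep 𝒯) (Q : TCat (idTheory V)) where
  /-- the quotient map -/
  q : Y.obj.carrier → Q.carrier
  /-- the section -/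
  s : Q.carrier → Y.obj.carrier
  q_le : ∀ x y, Y.obj.str (𝒯.e _ x) y ≤ Q.str (q x) (q y)
  s_le : ∀ x y, Q.str x y ≤ Y.obj.str (𝒯.e _ (s x)) (s y)
  q_s : ∀ x, q (s x) = x
  q_lim : ∀ t, q (Y.lim (𝒯.map (fun y => s (q y)) t)) = q (Y.lim t)

namespace SplitQuotient

variable {Y : CocomplSep 𝒯} {Q : TCat (idTheory V)} (D : SplitQuotient Y Q)

/-- The representing map of the quotient. -/
noncomputable def lim (t : 𝒯.T.obj Q.carrier) : Q.carrier := D.q (Y.lim (𝒯.map D.s t))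

theorem lim_e (x : Q.carrier) : D.lim (𝒯.e _ x) = x := by
  rw [lim, map_e, Y.lim_e, D.q_s]

/-- By this, `q` is a homomorphism for the representing maps; it is where `q_lim` is used. -/
theorem lim_map_q (t : 𝒯.T.obj Y.obj.carrier) : D.lim (𝒯.map D.q t) = D.q (Y.lim t) := by
  rw [lim, map_map, D.q_lim]

theorem lim_map_lim (t : 𝒯.T.obj (𝒯.T.obj Q.carrier)) :
    D.lim (𝒯.map D.lim t) = D.lim (𝒯.m _ t) := by
  have h : 𝒯.map D.lim t = 𝒯.map D.q (𝒯.map Y.lim (𝒯.map (𝒯.map D.s) t)) := by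
    rw [map_map, map_map]
    rfl
  rw [h, lim_map_q, Y.lim_map_lim, ← map_m]
  rfl

theorem Txi_le (t s : 𝒯.T.obj Q.carrier) :
    Txi 𝒯 (X := Q.carrier) Q.str t s ≤ Q.str (D.lim t) (D.lim s) := by
  refine (Txi_mono 𝒯 (X := Q.carrier) (r := Q.str)
    (r' := fun x y => Y.obj.toVCat.str (D.s x) (D.s y)) D.s_le t s).trans ?_
  refine ((Txi_map_left 𝒯 (X := Q.carrier) D.s
    (fun x y => Y.obj.toVCat.str x (D.s y)) _ _).trans
      (Txi_map_right 𝒯 (Y := Q.carrier) D.s Y.obj.toVCat.str _ _)).le.trans ?_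
  exact (Y.Txi_le_lim _ _).trans (D.q_le _ _)

/-- The `T`-category on the quotient. -/
noncomputable def tcat : TCat 𝒯 where
  carrier := Q.carrier
  str := fun t x => Q.str (D.lim t) x
  refl := fun x => by
    rw [D.lim_e]
    exact Q.refl x
  trans := fun t s x => by
    refine (mul_le_mul_left ((Txi_map_left 𝒯 (X' := Q.carrier) D.lim Q.str t s).le.trans
      (D.Txi_le _ _)) _).trans ?_
    rw [D.lim_map_lim]
    exact Q.v_trans _ _ _

theorem tcat_str_e (x y : Q.carrier) : D.tcat.str (𝒯.e Q.carrier x) y = Q.str x y :=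
  congrArg (fun z => Q.str z y) (D.lim_e x)

theorem tcat_isLSeparated (hQ : IsLSeparated Q) : IsLSeparated D.tcat := by
  rw [isLSeparated_iff] at hQ ⊢
  intro x y hxy hyx
  exact hQ x y (hxy.trans_eq (D.tcat_str_e x y)) (hyx.trans_eq (D.tcat_str_e y x))

/-- The quotient map, as a `T`-functor. -/
noncomputable def proj : TFunctor Y.obj D.tcat where
  toFun := D.q
  str_le := fun t y => by
    refine (Y.str_e_lim t y).ge.trans ((D.q_le _ _).trans_eq ?_)
    exact congrArg (fun z => Q.str z (D.q y)) (D.lim_map_q t).symm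

theorem proj_adjunction {r : Q.carrier → Y.obj.carrier} (hQ : IsLSeparated Q)
    (hr : ∀ y z, Q.str (D.q y) z = Y.obj.str (𝒯.e _ y) (r z)) :
    ∃ g : TFunctor D.tcat Y.obj, (∀ z, D.q (g.toFun z) = z) ∧
      ∀ t z, D.tcat.str (𝒯.map D.proj.toFun t) z = Y.obj.str t (g.toFun z) := by
  -- The counit is `q (r z) ≤ z`. Conversely `q (s z) = z` gives `s z ≤ r z`, and `q` maps this to
  -- `z ≤ q (r z)`.
  have hqr : ∀ z, D.q (r z) = z := by
    intro z
    refine (isLSeparated_iff Q).1 hQ _ _ ?_ ?_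
    · exact (Y.obj.refl (r z)).trans_eq (hr (r z) z).symm
    · have h : (1 : V) ≤ Y.obj.str (𝒯.e _ (D.s z)) (r z) := by
        rw [← hr, D.q_s]
        exact Q.refl z
      have h' := h.trans (D.q_le _ _)
      rw [D.q_s] at h'
      exact h'
  have hadj : ∀ t z, Q.str (D.lim (𝒯.map D.q t)) z = Y.obj.str t (r z) := by
    intro t z
    rw [D.lim_map_q, hr, Y.str_e_lim]
  refine ⟨⟨r, fun t z => ?_⟩, hqr, hadj⟩
  refine le_trans (le_of_eq ?_) (hadj (𝒯.map r t) z).le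
  refine congrArg (fun s => Q.str (D.lim s) z) ?_
  refine Eq.trans ?_ (map_map 𝒯 r D.q t).symm
  simp only [hqr]
  exact (map_id_apply 𝒯 t).symm

end SplitQuotient

/-- Colimits in `Y` are formed in `X` after applying `g` and are carried back by the left adjoint
`f`. -/
theorem IsCocomplete.of_retract {X Y : TCat 𝒯} (hX : IsCocomplete X) (f : TFunctor X Y)
    (g : TFunctor Y X) (hfg : ∀ y, f.toFun (g.toFun y) = y)
    (hadj : ∀ t y, Y.str (𝒯.map f.toFun t) y = X.str t (g.toFun y)) : IsCocomplete Y := by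
  intro A Z h ψ hψ
  obtain ⟨k, hk⟩ := hX A Z (g.comp h) ψ hψ
  refine ⟨f.comp k, ?_⟩
  funext z y
  have h₁ : (f.comp k).lowerStar z y = X.str (𝒯.map k.toFun z) (g.toFun y) := by
    rw [← hadj, map_map]
    rfl
  have h₂ : ∀ a, h.lowerStar a y = (g.comp h).lowerStar a (g.toFun y) := by
    intro a
    change _ = X.str _ _
    rw [← hadj, map_map]
    simp only [TFunctor.comp, hfg]
    rfl
  rw [h₁]
  refine Eq.trans ?_ (congrFun (congrFun hk z) (g.toFun y))
  simp only [kleisliExt, relExt, h₂]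

end Monadicity

/-! ### Verification of Beck's conditions for `S`. -/

section Beck

variable {V : Type u} [CommMonoid V] [CompleteLattice V] [IsQuantale V] {𝒯 : TopologicalTheory V}

/-! ### Split coequalizers -/

/-- For a `V`-functor `q : Y → Q` and `z` in `Q`, the presheaf `t ↦ T_ξ c (T q t, e z)` on the free
`T`-category over `Y`, where `c` is the structure of `Q`. -/
def TFunctor.fiberPresheaf (𝒯 : TopologicalTheory V) {Y Q : TCat (idTheory V)} (q : TFunctor Y Q)
    (z : Q.carrier) : Presheaf (Y.free 𝒯) :=
  ⟨fun t => Txi 𝒯 (X := Y.carrier) (fun y z => Q.str (q.toFun y) z) t (𝒯.e Q.carrier z), by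
    intro t s
    refine (mul_le_mul_left (Txi_map_right 𝒯 (𝒯.e Y.carrier)
      (Txi 𝒯 (X := Y.carrier) Y.str) t s).le _).trans ?_
    refine (mul_le_mul_left (Txi_Txi_le 𝒯 (X := Y.carrier) Y.str t _) _).trans ?_
    refine (le_of_eq (congrArg (fun s' => Txi 𝒯 (X := Y.carrier) Y.str _ s' * _)
      (m_map_e 𝒯 (X := Y.carrier) s))).trans ?_
    refine (Txi_mul_le 𝒯 (X := Y.carrier) (Y := Y.carrier) _ _ _ _ _).trans
      (Txi_mono 𝒯 (fun x z => iSup_le fun y => ?_) _ _)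
    exact (mul_le_mul_left (q.str_le x y) _).trans (Q.v_trans _ _ _), by
    intro t
    let r : Y.carrier → Q.carrier → V := fun y z => Q.str (q.toFun y) z
    refine (Txi_e_right (fun s z => Txi 𝒯 r s (𝒯.e Q.carrier z)) t z).ge.trans ?_
    refine (Txi_map_right 𝒯 (𝒯.e Q.carrier) (Txi 𝒯 r) t (𝒯.e Q.carrier z)).le.trans ?_
    refine (Txi_Txi_le 𝒯 r t _).trans_eq ?_
    rw [m_map_e]
    rfl⟩

theorem exists_leftAdjoint_extension {Z : TCat (idTheory V)} {Y : CocomplSep 𝒯}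
    (h : TFunctor Z Y.obj.toVCat) : ∃ k : CocomplSep.psh (Z.free 𝒯) ⟶ Y,
      ∀ (ψ : Presheaf (Z.free 𝒯)) (y : Y.obj.carrier),
        1 ≤ Y.obj.str (𝒯.e _ (k.fn.toFun ψ)) y ↔
          ∀ t : 𝒯.T.obj Z.carrier, ψ.1 t ≤ Y.obj.str (𝒯.map h.toFun t) y := by
  obtain ⟨k, hk, hk'⟩ := exists_extension Y.sep Y.cocomplete ((freeEquiv Z Y.obj).symm h)
  refine ⟨⟨k, hk⟩, fun ψ y => (le_str_e_iff hk ψ y 1).trans (forall_congr' fun t => ?_)⟩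
  rw [mul_one]
  exact Eq.to_iff (congrArg (fun f => ψ.1 t ≤ Y.obj.str (𝒯.map (TFunctor.toFun f) t) y) hk')

/-- Morally `r z` is the colimit of all `y` with `q y ≤ z`, but `q` is not known to preserve
colimits. So the colimit `k ψ` of `t`, weighted by the fibre presheaf `ψ` of `z`, is formed in `X`.
Since `g` preserves it and `g t = 1`, `r z = g (k ψ)` is the desired colimit in `Y`. Since `f`
preserves it and `f t = s q`, `f (k ψ) ≤ s z`, whence `q (r z) = q (f (k ψ)) ≤ q (s z) = z`. -/
theorem TFunctor.exists_rightAdjoint_of_split {X Y : CocomplSep 𝒯} (f g : X ⟶ Y)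
    {Q : TCat (idTheory V)} (q : TFunctor Y.obj.toVCat Q) (s : TFunctor Q Y.obj.toVCat)
    (t : TFunctor Y.obj.toVCat X.obj.toVCat)
    (hq : ∀ x, q.toFun (f.fn.toFun x) = q.toFun (g.fn.toFun x))
    (hs : ∀ z, q.toFun (s.toFun z) = z) (hg : ∀ y, g.fn.toFun (t.toFun y) = y)
    (hf : ∀ y, f.fn.toFun (t.toFun y) = s.toFun (q.toFun y)) :
    ∃ r : Q.carrier → Y.obj.carrier, ∀ y z,
      Q.str (q.toFun y) z = Y.obj.str (𝒯.e _ y) (r z) := by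
  obtain ⟨k, hk⟩ := exists_leftAdjoint_extension t
  have hcomp : ∀ (f : X ⟶ Y) (ψ : Presheaf (Y.obj.toVCat.free 𝒯)) (y : Y.obj.carrier),
      1 ≤ Y.obj.str (𝒯.e _ (f.fn.toFun (k.fn.toFun ψ))) y ↔
        ∀ w : 𝒯.T.obj Y.obj.carrier,
          ψ.1 w ≤ Y.obj.str (𝒯.map (fun y => f.fn.toFun (t.toFun y)) w) y := by
    intro f ψ y
    obtain ⟨f', hf'⟩ := f.fn.isLeftAdjoint_iff.1 f.isLeftAdjoint
    rw [← map_e, hf', hk]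
    refine forall_congr' fun w => ?_
    rw [← hf']
    exact Eq.to_iff (congrArg (fun s => ψ.1 w ≤ Y.obj.str s y) (map_map 𝒯 t.toFun f.fn.toFun w))
  refine ⟨fun z => g.fn.toFun (k.fn.toFun (q.fiberPresheaf 𝒯 z)), fun y z => le_antisymm ?_ ?_⟩
  · have h := (hcomp g (q.fiberPresheaf 𝒯 z) _).1 (Y.obj.refl _) (𝒯.e _ y)
    simp only [hg] at h
    refine le_trans ?_ (h.trans_eq (congrArg (fun s => Y.obj.str s _) (map_id_apply 𝒯 _)))
    exact le_Txi_e 𝒯 (X := Y.obj.carrier) (fun y z => Q.str (q.toFun y) z) y z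
  · have h : (1 : V) ≤ Q.str (q.toFun (g.fn.toFun (k.fn.toFun (q.fiberPresheaf 𝒯 z)))) z := by
      rw [← hq]
      -- Only the target `z` becomes `q (s z)`; the `z` inside the fibre presheaf stays.
      nth_rewrite 2 [← hs z]
      refine le_trans ?_ (q.str_le _ _)
      refine (hcomp f (q.fiberPresheaf 𝒯 z) (s.toFun z)).2 fun w => ?_
      simp only [hf]
      refine le_trans ?_ (Y.obj.Txi_toVCat_e_le _ _)
      have h₁ : Txi 𝒯 (X := Y.obj.carrier) (fun y z => Q.str (q.toFun y) z) w (𝒯.e Q.carrier z) ≤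
          Txi 𝒯 (X := Y.obj.carrier) (fun y z => Y.obj.toVCat.str (s.toFun (q.toFun y)) (s.toFun z))
            w (𝒯.e Q.carrier z) := Txi_mono 𝒯 (fun y z => s.str_le _ _) _ _
      refine h₁.trans ((Txi_map_left 𝒯 (fun y : Y.obj.carrier => s.toFun (q.toFun y))
        (fun x z => Y.obj.toVCat.str x (s.toFun z)) _ _).trans
        ((Txi_map_right 𝒯 (Y := Q.carrier) s.toFun Y.obj.toVCat.str _ _).trans ?_)).le
      exact congrArg (Txi 𝒯 (X := Y.obj.carrier) Y.obj.toVCat.str _) (map_e 𝒯 s.toFun z)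
    refine (q.str_le y _).trans ((mul_one _).ge.trans ((mul_le_mul_right h _).trans ?_))
    exact Q.v_trans _ _ _

theorem exists_coequalizer_of_split {X Y : CocomplSep 𝒯} (f g : X ⟶ Y)
    {Q : CatSep (idTheory V)} {π : (forgetCocomplSep 𝒯).obj Y ⟶ Q}
    (S : IsSplitCoequalizer ((forgetCocomplSep 𝒯).map f) ((forgetCocomplSep 𝒯).map g) π) :
    ∃ (C : CocomplSep 𝒯) (p : Y ⟶ C) (w : f ≫ p = g ≫ p),
      Nonempty (Limits.IsColimit (Limits.Cofork.ofπ p w)) ∧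
      Nonempty (IsSplitCoequalizer ((forgetCocomplSep 𝒯).map f) ((forgetCocomplSep 𝒯).map g)
        ((forgetCocomplSep 𝒯).map p)) := by
  have ptw : ∀ {A B : CatSep (idTheory V)} {a b : A ⟶ B}, a = b → ∀ x,
      TFunctor.toFun a.hom x = TFunctor.toFun b.hom x := fun h x => by rw [h]
  let q : TFunctor Y.obj.toVCat Q.obj := π.hom
  let s : TFunctor Q.obj Y.obj.toVCat := S.rightSection.hom
  let t : TFunctor Y.obj.toVCat X.obj.toVCat := S.leftSection.hom
  have hq : ∀ x, q.toFun (f.fn.toFun x) = q.toFun (g.fn.toFun x) := ptw S.condition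
  have hs : ∀ z, q.toFun (s.toFun z) = z := ptw S.rightSection_π
  have hg : ∀ y, g.fn.toFun (t.toFun y) = y := ptw S.leftSection_bottom
  have hf : ∀ y, f.fn.toFun (t.toFun y) = s.toFun (q.toFun y) := ptw S.leftSection_top
  let D : SplitQuotient Y Q.obj :=
    { q := q.toFun
      s := s.toFun
      q_le := q.str_le
      s_le := s.str_le
      q_s := hs
      -- `q lim T(s q) w = q f lim (T t w) = q g lim (T t w) = q lim w`, as `f` and `g` preserve
      -- `lim`.
      q_lim := fun w => by
        have h₁ := (g.map_lim (𝒯.map t.toFun w)).trans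
          (congrArg Y.lim (map_map 𝒯 t.toFun g.fn.toFun w))
        have h₂ := (f.map_lim (𝒯.map t.toFun w)).trans
          (congrArg Y.lim (map_map 𝒯 t.toFun f.fn.toFun w))
        simp only [hg] at h₁
        simp only [hf] at h₂
        refine (congrArg q.toFun h₂).symm.trans ((hq _).trans (congrArg q.toFun ?_))
        refine h₁.trans (congrArg Y.lim ?_)
        exact map_id_apply 𝒯 w }
  obtain ⟨r, hr⟩ := TFunctor.exists_rightAdjoint_of_split f g q s t hq hs hg hf
  obtain ⟨q', hq', hadj⟩ := D.proj_adjunction Q.property hr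
  let C : CocomplSep 𝒯 :=
    ⟨D.tcat, D.tcat_isLSeparated Q.property, Y.cocomplete.of_retract D.proj q' hq' hadj⟩
  let p : Y ⟶ C := ⟨D.proj, D.proj.isLeftAdjoint_iff.2 ⟨q', hadj⟩⟩
  have w : f ≫ p = g ≫ p := CocomplSep.Hom.ext (TFunctor.ext (funext hq))
  -- The underlying `V`-category of the quotient has the structure of `Q`, so the old splitting also
  -- splits `S p`.
  let s' : TFunctor D.tcat.toVCat Y.obj.toVCat :=
    ⟨s.toFun, fun x y => (D.tcat_str_e x y).le.trans (s.str_le x y)⟩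
  refine ⟨C, p, w, ⟨Limits.Cofork.IsColimit.mk' _ fun c => ?_⟩, ⟨?_⟩⟩
  · let k : Y ⟶ c.pt := c.π
    have hk : ∀ x, k.fn.toFun (f.fn.toFun x) = k.fn.toFun (g.fn.toFun x) := fun x =>
      congrArg (fun m : X ⟶ c.pt => m.fn.toFun x) c.condition
    have hksq : ∀ y, k.fn.toFun (s.toFun (q.toFun y)) = k.fn.toFun y := fun y =>
      (congrArg k.fn.toFun (hf y)).symm.trans ((hk _).trans (congrArg k.fn.toFun (hg y)))
    let l : TFunctor D.tcat c.pt.obj :=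
      { toFun := fun z => k.fn.toFun (s.toFun z)
        str_le := fun t z => by
          -- The factor `k s` is a `T`-functor because `k s q = k` and `k` preserves `lim`.
          refine (s.str_le (D.lim t) z).trans ((k.fn.str_le _ _).trans ?_)
          refine le_of_eq ((congrArg (fun x => c.pt.obj.str x _) ?_).trans (c.pt.str_e_lim _ _))
          refine (map_e 𝒯 k.fn.toFun _).trans (congrArg (𝒯.e _) ?_)
          refine (hksq (Y.lim (𝒯.map s.toFun t))).trans ((k.map_lim _).trans ?_)
          exact congrArg c.pt.lim (map_map 𝒯 s.toFun k.fn.toFun t) }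
    -- If `k` is left adjoint to `k'`, then `k s` is left adjoint to `q k'`: apply `q` to the unit
    -- at `s z`, and use `k s q = k` for the counit.
    have hl : l.IsLeftAdjoint := by
      obtain ⟨k', hk₁, hk₂⟩ := k.isLeftAdjoint
      rw [TFunctor.le_iff] at hk₁ hk₂
      refine ⟨D.proj.comp k', (TFunctor.le_iff _ _).2 fun z => ?_,
        (TFunctor.le_iff _ _).2 fun x => ?_⟩
      · refine (hk₁ (s.toFun z)).trans ((D.proj.str_le _ _).trans_eq ?_)
        refine congrArg (fun x => D.tcat.str x _) ((map_e 𝒯 D.q _).trans ?_)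
        exact congrArg (𝒯.e _) (hs z)
      · refine (hk₂ x).trans_eq (congrArg (fun y => c.pt.obj.str (𝒯.e _ y) x) ?_)
        exact (hksq (k'.toFun x)).symm
    refine ⟨⟨l, hl⟩, CocomplSep.Hom.ext (TFunctor.ext (funext hksq)), fun {m} hm => ?_⟩
    refine CocomplSep.Hom.ext (TFunctor.ext (funext fun z => ?_))
    have h := congrArg (fun m : Y ⟶ c.pt => m.fn.toFun (s.toFun z)) hm
    exact (congrArg m.fn.toFun (hs z)).symm.trans h
  · refine
      { rightSection := ObjectProperty.homMk s'
        leftSection := S.leftSection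
        condition := by rw [← Functor.map_comp, w, Functor.map_comp]
        rightSection_π := ?_
        leftSection_bottom := S.leftSection_bottom
        leftSection_top := ?_ }
    · exact ObjectProperty.hom_ext _ (TFunctor.ext (funext hs))
    · exact ObjectProperty.hom_ext _ (TFunctor.ext (funext hf))

instance forgetCocomplSep_hasCoequalizerOfIsSplitPair :
    Monad.HasCoequalizerOfIsSplitPair (forgetCocomplSep 𝒯) where
  out f g h := by
    obtain ⟨Q, π, ⟨S⟩⟩ := h.splittable
    obtain ⟨C, p, w, ⟨hc⟩, -⟩ := exists_coequalizer_of_split f g S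
    exact Limits.HasColimit.mk ⟨_, hc⟩

instance forgetCocomplSep_preservesColimitOfIsSplitPair :
    Monad.PreservesColimitOfIsSplitPair (forgetCocomplSep 𝒯) where
  out f g h := by
    obtain ⟨Q, π, ⟨S⟩⟩ := h.splittable
    obtain ⟨C, p, w, ⟨hc⟩, ⟨S'⟩⟩ := exists_coequalizer_of_split f g S
    exact Limits.preservesColimit_of_preserves_colimit_cocone hc
      ((Limits.isColimitMapCoconeCoforkEquiv (forgetCocomplSep 𝒯) w).symm S'.isCoequalizer)

instance forgetCocomplSep_reflectsIsomorphisms :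
    (forgetCocomplSep 𝒯).ReflectsIsomorphisms where
  reflects {X Y} f hf := by
    obtain ⟨u, hu₁, hu₂⟩ := hf.out
    obtain ⟨g, hg₁, hg₂⟩ := f.isLeftAdjoint
    have h₁ := (TFunctor.le_iff _ _).1 hg₁
    have h₂ := (TFunctor.le_iff _ _).1 hg₂
    let u' : TFunctor Y.obj.toVCat X.obj.toVCat := u.hom
    have huf : ∀ x, u'.toFun (f.fn.toFun x) = x := fun x =>
      congrArg (fun m : (forgetCocomplSep 𝒯).obj X ⟶ (forgetCocomplSep 𝒯).obj X =>
        TFunctor.toFun m.hom x) hu₁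
    have hfu : ∀ y, f.fn.toFun (u'.toFun y) = y := fun y =>
      congrArg (fun m : (forgetCocomplSep 𝒯).obj Y ⟶ (forgetCocomplSep 𝒯).obj Y =>
        TFunctor.toFun m.hom y) hu₂
    -- The `V`-functor `u` inverse to `f` turns the counit `f g f x ≤ f x` into `g f x ≤ x`. Hence
    -- `g` is a `T`-functor inverse to `f`.
    have hgf : ∀ x, g.toFun (f.fn.toFun x) = x := by
      intro x
      refine (isLSeparated_iff X.obj).1 X.sep _ _ ?_ (h₁ x)
      have h := (h₂ (f.fn.toFun x)).trans (u'.str_le _ _)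
      change 1 ≤ X.obj.str (𝒯.e _ (u'.toFun (f.fn.toFun (g.toFun (f.fn.toFun x)))))
        (u'.toFun (f.fn.toFun x)) at h
      rwa [huf, huf] at h
    have hfg : ∀ y, f.fn.toFun (g.toFun y) = y := by
      intro y
      rw [← hfu y]
      exact congrArg f.fn.toFun (hgf _)
    have hfg' : f.fn.comp g = TFunctor.id _ := TFunctor.ext (funext hfg)
    have hgf' : g.comp f.fn = TFunctor.id _ := TFunctor.ext (funext hgf)
    exact ⟨⟨g, f.fn, hfg'.ge, hgf'.le⟩, CocomplSep.Hom.ext hgf', CocomplSep.Hom.ext hfg'⟩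

end Beck

end TopTheory

theorem mainTheorem8 {V : Type u} [CommMonoid V] [CompleteLattice V] [IsQuantale V]
    (hV : (⊥ : V) < 1) (𝒯 : TopTheory.TopologicalTheory V) :
    Nonempty (MonadicRightAdjoint (TopTheory.forgetCocomplSep 𝒯)) :=
  ⟨Monad.monadicOfHasPreservesGSplitCoequalizersOfReflectsIsomorphisms
    (TopTheory.pshFreeAdjunction 𝒯)⟩
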